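/- Let $X$ be a Polish space, and let $\mathcal M(X)$ (resp. $\mathcal P(X)$) be the space of finite non-negative Borel measures (resp. Borel probability measures) on $X$, with the weak topology and its Borel $\sigma$-algebra. For $r\ge 0$ let $\mathcal B_r=\{\mu\in\mathcal M(X):\mu X\le r\}$. Definitions. A Borel measure $\mathcal Q$ on $\mathcal M(X)$ is *projectively invariant* if for every bounded Borel $a\colon X\to\mathbb R$ there is a constant $c\in[0,\infty]$ with $(e^a\cdot)_\sharp\mathcal Q=c\,\mathcal Q$, where $(e^a\cdot)$ is the map $\mu\mapsto e^a\mu$. For a non-zero $\beta\in\mathcal M(X)$, the Dirichlet–Ferguson measure $\mathcal D_\beta$ with intensity $\beta$ is the unique Borel probability measure on $\mathcal P(X)$ under which, for every finite Borel partition $A_1,\dots,A_n$ of $X$, the vector $(\eta A_1,\dots,\eta A_n)$ has the Dirichlet distribution with parameters $(\beta A_1,\dots,\beta A_n)$, i.e. the law of $(Z_i/\sum_j Z_j)_i$ for independent $Z_i$ with Gamma distribution of shape $\beta A_i$ and rate $1$ (and $Z_i=0$ if $\beta A_i=0$). For $\theta>0$ let $d\lambda_\theta(t)=\frac{t^{\theta-1}}{\Gamma(\theta)}dt$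 on $(0,\infty)$. For $\theta>0$ and $\nu\in\mathcal P(X)$, the multiplicative infinite-dimensional Lebesgue measure $\mathcal L_{\theta,\nu}$ on $\mathcal M(X)$ is the push-forward of $\mathcal D_{\theta\nu}\otimes\lambda_\theta$ under $(\eta,t)\mapsto t\eta$. Proposition. Let $\mathcal Q$ be a non-zero, non-negative, projectively invariant Borel measure on $\mathcal M(X)$ such that $\mathcal Q\mathcal B_0=0$ and $0<\mathcal Q\mathcal B_r<\infty$ for some $r>0$. Then: (i) $k_t:=\int e^{-t\,\mu X}\,d\mathcal Q(\mu)$ is positive and finite for every $t>0$; (ii) $\alpha:=\int\mu(\,\cdot\,)\,e^{-\mu X}\,d\mathcal Q(\mu)$ is a finite, non-zero, non-negative Borel measure on $X$; (iii) letting $\theta:=\alpha X/k_1$ and $\nu:=\alpha/\alpha X$, the Dirichlet–Ferguson measure $\mathcal D_{\theta\nu}$ exists and is unique, and $\mathcal Q=k_1\,\mathcal L_{\theta,\nu}$. -/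

import Mathlib

open MeasureTheory ProbabilityTheory Filter Topology
open scoped ENNReal NNReal BoundedContinuousFunction

/-! ## The space of finite measures

`FiniteMeasure X` and `ProbabilityMeasure X` carry the weak topology.  Mathlib equips them with the
`σ`-algebra generated by the evaluations; on a Polish space it is the Borel `σ`-algebra of the weak
topology, as shown by the two `BorelSpace` instances below. -/

section BorelStructure

variable {X : Type*} [MeasurableSpace X]

theorem measurable_finiteMeasure_coe :
    Measurable (fun μ : FiniteMeasure X => (μ : Measure X)) :=
  measurable_subtype_coe

theorem measurable_finiteMeasure_apply {A : Set X} (hA : MeasurableSet A) :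
    Measurable (fun μ : FiniteMeasure X => μ A) :=
  ((Measure.measurable_coe hA).comp measurable_finiteMeasure_coe).ennreal_toNNReal

/-- If the masses of the sets of a sufficiently rich countable family converge, then the measures
converge weakly. -/
theorem finiteMeasure_tendsto_of_family [TopologicalSpace X] [BorelSpace X] {V : ℕ → Set X}
    (hV : ∀ G : Set X, IsOpen G → ∀ μ : FiniteMeasure X,
      (μ : Measure X) G ≤ ⨆ n : {n : ℕ // V n ⊆ G}, (μ : Measure X) (V n))
    {u : ℕ → FiniteMeasure X} {μ : FiniteMeasure X}
    (h : ∀ n, Tendsto (fun i => u i (V n)) atTop (𝓝 (μ (V n))))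
    (hm : Tendsto (fun i => (u i).mass) atTop (𝓝 μ.mass)) :
    Tendsto u atTop (𝓝 μ) := by
  have hopen : ∀ G : Set X, IsOpen G →
      (μ : Measure X) G ≤ liminf (fun i => (u i : Measure X) G) atTop := by
    intro G hG
    refine (hV G hG μ).trans (iSup_le fun n => ?_)
    have hn : Tendsto (fun i => (u i : Measure X) (V n)) atTop (𝓝 ((μ : Measure X) (V n))) := by
      simpa only [← FiniteMeasure.ennreal_coeFn_eq_coeFn_toMeasure] using
        ENNReal.tendsto_coe.2 (h n)
    rw [← hn.liminf_eq]
    exact liminf_le_liminf (Eventually.of_forall fun i => measure_mono n.2)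
  have hlow : ∀ f : X →ᵇ ℝ≥0, ∀ c : ℝ≥0, c < μ.testAgainstNN f →
      ∀ᶠ i in atTop, c < (u i).testAgainstNN f := by
    intro f c hc
    have key := lintegral_le_liminf_lintegral_of_forall_isOpen_measure_le_liminf_measure
      (f := fun x => (f x : ℝ)) (μ := (μ : Measure X)) (μs := fun i => (u i : Measure X))
      (NNReal.continuous_coe.comp f.continuous) (fun x => NNReal.coe_nonneg _) hopen
    simp only [ENNReal.ofReal_coe_nnreal, ← FiniteMeasure.testAgainstNN_coe_eq] at key
    filter_upwards [eventually_lt_of_lt_liminf ((ENNReal.coe_lt_coe.2 hc).trans_le key)] with i hi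
    exact ENNReal.coe_lt_coe.1 hi
  rw [FiniteMeasure.tendsto_iff_forall_testAgainstNN_tendsto]
  intro f
  obtain ⟨C, hC⟩ : ∃ C : ℝ≥0, ∀ x, f x ≤ C := by
    obtain ⟨C, hC⟩ := f.isBounded_range.bddAbove
    exact ⟨C, fun x => hC ⟨x, rfl⟩⟩
  let g : X →ᵇ ℝ≥0 := BoundedContinuousFunction.const X C - f
  have hsum : ∀ κ : FiniteMeasure X, κ.testAgainstNN f + κ.testAgainstNN g = C * κ.mass := by
    intro κ
    rw [← FiniteMeasure.testAgainstNN_add, ← FiniteMeasure.testAgainstNN_const]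
    congr 1
    ext x
    have : f x + (C - f x) = C := add_tsub_cancel_of_le (hC x)
    simpa [g] using congrArg NNReal.toReal this
  refine tendsto_order.2 ⟨fun c hc => hlow f c hc, fun c hc => ?_⟩
  have hCm : Tendsto (fun i => C * (u i).mass) atTop (𝓝 (C * μ.mass)) := hm.const_mul C
  obtain ⟨ε, hε, hcε⟩ : ∃ ε : ℝ≥0, 0 < ε ∧ μ.testAgainstNN f + 2 * ε ≤ c := by
    refine ⟨(c - μ.testAgainstNN f) / 2, by simpa using hc, ?_⟩
    rw [mul_div_cancel₀ _ two_ne_zero, add_tsub_cancel_of_le hc.le]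
  have h1 : ∀ᶠ i in atTop, C * (u i).mass < C * μ.mass + ε :=
    (tendsto_order.1 hCm).2 _ (lt_add_of_pos_right _ hε)
  have h2 : ∀ᶠ i in atTop, μ.testAgainstNN g < (u i).testAgainstNN g + ε := by
    by_cases hg : μ.testAgainstNN g < ε
    · exact Eventually.of_forall fun i => hg.trans_le le_add_self
    · have hlt : μ.testAgainstNN g - ε < μ.testAgainstNN g :=
        tsub_lt_self (hε.trans_le (not_lt.1 hg)) hε
      filter_upwards [hlow g _ hlt] with i hi
      exact (tsub_lt_iff_right (not_lt.1 hg)).1 hi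
  filter_upwards [h1, h2] with i h1 h2
  rw [← hsum, ← hsum] at h1
  rw [← NNReal.coe_lt_coe] at h1 h2 ⊢
  rw [← NNReal.coe_le_coe] at hcε
  push_cast at *
  linarith

variable [TopologicalSpace X] [PolishSpace X]

/-- A countable family of open sets exhausting every open set in measure. -/
theorem exists_exhausting_family : ∃ V : ℕ → Set X, (∀ n, IsOpen (V n)) ∧
    ∀ G : Set X, IsOpen G → ∀ μ : FiniteMeasure X,
      (μ : Measure X) G ≤ ⨆ n : {n : ℕ // V n ⊆ G}, (μ : Measure X) (V n) := by
  have hB := TopologicalSpace.isBasis_countableBasis X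
  have hBc := TopologicalSpace.countable_countableBasis X
  have hS : {t : Set (Set X) | t.Finite ∧ t ⊆ TopologicalSpace.countableBasis X}.Countable :=
    Set.countable_ofPred_finite_subset hBc
  obtain ⟨T, hT⟩ := hS.exists_eq_range ⟨∅, Set.finite_empty, Set.empty_subset _⟩
  have hTmem : ∀ n, (T n).Finite ∧ T n ⊆ TopologicalSpace.countableBasis X := fun n => by
    have : T n ∈ Set.range T := ⟨n, rfl⟩
    rwa [← hT] at this
  refine ⟨fun n => ⋃₀ T n, fun n => isOpen_sUnion fun s hs => hB.isOpen ((hTmem n).2 hs),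
    fun G hG μ => ?_⟩
  have hdir : Directed (· ⊆ ·) (fun n : {n : ℕ // ⋃₀ T n ⊆ G} => ⋃₀ T n) := by
    rintro ⟨m, hm⟩ ⟨n, hn⟩
    have : T m ∪ T n ∈ Set.range T := by
      rw [← hT]
      exact ⟨(hTmem m).1.union (hTmem n).1, Set.union_subset (hTmem m).2 (hTmem n).2⟩
    obtain ⟨k, hk⟩ := this
    have hku : ⋃₀ T k = ⋃₀ T m ∪ ⋃₀ T n := by rw [hk, Set.sUnion_union]
    refine ⟨⟨k, by rw [hku]; exact Set.union_subset hm hn⟩, ?_, ?_⟩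
    · change ⋃₀ T m ⊆ ⋃₀ T k
      rw [hku]; exact Set.subset_union_left
    · change ⋃₀ T n ⊆ ⋃₀ T k
      rw [hku]; exact Set.subset_union_right
  rw [← hdir.measure_iUnion]
  refine measure_mono fun x hx => ?_
  obtain ⟨U, hU, hxU, hUG⟩ := hB.exists_subset_of_mem_open hx hG
  have : ({U} : Set (Set X)) ∈ Set.range T := by
    rw [← hT]
    exact ⟨Set.finite_singleton U, Set.singleton_subset_iff.2 hU⟩
  obtain ⟨k, hk⟩ := this
  refine Set.mem_iUnion.2 ⟨⟨k, ?_⟩, ?_⟩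
  · rw [hk, Set.sUnion_singleton]; exact hUG
  · change x ∈ ⋃₀ T k
    rw [hk, Set.sUnion_singleton]; exact hxU

variable [BorelSpace X]

instance borelSpace_finiteMeasure : BorelSpace (FiniteMeasure X) := by
  refine ⟨le_antisymm ?_ ?_⟩
  · -- evaluations are Borel
    have hm : @Measurable (FiniteMeasure X) (Measure X) (borel _) _
        (fun μ : FiniteMeasure X => (μ : Measure X)) := by
      let _ : MeasurableSpace (FiniteMeasure X) := borel _
      have _ : BorelSpace (FiniteMeasure X) := ⟨rfl⟩
      refine Measurable.measure_of_isPiSystem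
        (S := {F : Set X | IsClosed F}) ?_ isPiSystem_isClosed ?_ ?_
      · rw [BorelSpace.measurable_eq (α := X), borel_eq_generateFrom_isClosed]
      · intro F hF
        refine measurable_of_tendsto_metrizable (f := fun n (μ : FiniteMeasure X) =>
          ∫⁻ x, (IsClosed.apprSeq hF n x : ℝ≥0∞) ∂(μ : Measure X)) (fun n => ?_) ?_
        · simp only [← FiniteMeasure.testAgainstNN_coe_eq]
          exact (FiniteMeasure.continuous_testAgainstNN_eval _).measurable.coe_nnreal_ennreal
        · rw [tendsto_pi_nhds]
          intro μ
          exact HasOuterApproxClosed.tendsto_lintegral_apprSeq hF (μ : Measure X)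
      · simp only [← FiniteMeasure.ennreal_mass]
        exact FiniteMeasure.continuous_mass.measurable.coe_nnreal_ennreal
    rintro _ ⟨s, hs, rfl⟩
    exact hm hs
  · obtain ⟨V, hVo, hV⟩ := exists_exhausting_family (X := X)
    let Φ : FiniteMeasure X → (ℕ → ℝ≥0) × ℝ≥0 := fun μ => (fun n => μ (V n), μ.mass)
    have hΦ : Measurable Φ :=
      (measurable_pi_lambda _ fun n => measurable_finiteMeasure_apply (hVo n).measurableSet).prodMk
        (measurable_finiteMeasure_apply MeasurableSet.univ)
    have hlim : ∀ μ : FiniteMeasure X, Tendsto id (comap Φ (𝓝 (Φ μ))) (𝓝 μ) := by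
      intro μ
      refine tendsto_of_seq_tendsto fun u hu => ?_
      have hu' : Tendsto (fun i => Φ (u i)) atTop (𝓝 (Φ μ)) := tendsto_comap_iff.1 hu
      rw [nhds_prod_eq, tendsto_prod_iff'] at hu'
      exact finiteMeasure_tendsto_of_family hV (fun n => tendsto_pi_nhds.1 hu'.1 n) hu'.2
    refine MeasurableSpace.generateFrom_le fun O hO => ?_
    have hW : ∃ W : Set ((ℕ → ℝ≥0) × ℝ≥0), IsOpen W ∧ Φ ⁻¹' W = O := by
      refine ⟨⋃₀ {W | IsOpen W ∧ Φ ⁻¹' W ⊆ O}, isOpen_sUnion fun W hW => hW.1,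
        Set.Subset.antisymm ?_ ?_⟩
      · rintro μ ⟨W, hW, hμ⟩
        exact hW.2 hμ
      · intro μ hμ
        obtain ⟨N, hN, hNO⟩ := mem_comap.1 (hlim μ (IsOpen.mem_nhds hO hμ))
        obtain ⟨W, hWN, hWo, hμW⟩ := mem_nhds_iff.1 hN
        exact ⟨W, ⟨hWo, fun κ hκ => hNO (hWN hκ)⟩, hμW⟩
    obtain ⟨W, hWo, rfl⟩ := hW
    exact hΦ hWo.measurableSet

instance borelSpace_probabilityMeasure : BorelSpace (ProbabilityMeasure X) := by
  have hind : IsInducing (ProbabilityMeasure.toFiniteMeasure (Ω := X)) :=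
    (ProbabilityMeasure.toFiniteMeasure_isEmbedding X).isInducing
  have hcomp : (FiniteMeasure.toMeasure ∘ ProbabilityMeasure.toFiniteMeasure (Ω := X)) =
      ProbabilityMeasure.toMeasure := rfl
  have h1 : MeasurableSpace.comap (ProbabilityMeasure.toFiniteMeasure (Ω := X))
      (MeasurableSpace.comap FiniteMeasure.toMeasure Measure.instMeasurableSpace) =
      MeasurableSpace.comap ProbabilityMeasure.toMeasure Measure.instMeasurableSpace := by
    rw [MeasurableSpace.comap_comp, hcomp]
  have h2 : MeasurableSpace.comap (FiniteMeasure.toMeasure (Ω := X)) Measure.instMeasurableSpace =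
      borel (FiniteMeasure X) := (borelSpace_finiteMeasure (X := X)).measurable_eq
  have h3 : borel (ProbabilityMeasure X) = MeasurableSpace.comap
      (ProbabilityMeasure.toFiniteMeasure (Ω := X)) (borel (FiniteMeasure X)) := by
    rw [hind.eq_induced]
    exact borel_comap
  rw [h2, ← h3] at h1
  exact ⟨h1.symm⟩

end BorelStructure

noncomputable section

variable {X : Type*} [MeasurableSpace X]

/-! ## Multipliers and projective invariance -/

/-- Real-valued bounded measurable functions. -/
structure IsBddBorel (a : X → ℝ) : Prop where
  measurable : Measurable a
  bounded : ∃ C : ℝ, ∀ x, |a x| ≤ C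

theorem IsBddBorel.isFiniteMeasure_withDensity {a : X → ℝ} (ha : IsBddBorel a)
    (μ : Measure X) [IsFiniteMeasure μ] :
    IsFiniteMeasure (μ.withDensity fun x => ENNReal.ofReal (Real.exp (a x))) := by
  obtain ⟨C, hC⟩ := ha.bounded
  refine MeasureTheory.isFiniteMeasure_withDensity (ne_of_lt ?_)
  calc ∫⁻ x, ENNReal.ofReal (Real.exp (a x)) ∂μ
      ≤ ∫⁻ _, ENNReal.ofReal (Real.exp C) ∂μ := lintegral_mono fun x =>
        ENNReal.ofReal_le_ofReal (Real.exp_le_exp.2 ((le_abs_self _).trans (hC x)))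
    _ < ∞ := by
        rw [lintegral_const]
        exact ENNReal.mul_lt_top ENNReal.ofReal_lt_top (measure_lt_top μ _)

/-- The action `μ ↦ e^a · μ` of the multiplier `e^a` on finite measures. -/
def multiply (a : X → ℝ) (ha : IsBddBorel a) (μ : FiniteMeasure X) : FiniteMeasure X :=
  ⟨(μ : Measure X).withDensity fun x => ENNReal.ofReal (Real.exp (a x)),
    ha.isFiniteMeasure_withDensity _⟩

theorem measurable_multiply (a : X → ℝ) (ha : IsBddBorel a) : Measurable (multiply a ha) := by
  refine Measurable.subtype_mk (Measure.measurable_of_measurable_coe _ fun A hA => ?_)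
  simp only [withDensity_apply _ hA, ← lintegral_indicator hA]
  exact (Measure.measurable_lintegral
    ((ha.measurable.exp.ennreal_ofReal).indicator hA)).comp measurable_finiteMeasure_coe

/-- `Q` is projectively invariant under all multipliers: the push-forward of `Q` by `μ ↦ e^a · μ`
is a constant (depending on `a`) times `Q`. -/
def IsProjectivelyInvariant (Q : Measure (FiniteMeasure X)) : Prop :=
  ∀ (a : X → ℝ) (ha : IsBddBorel a), ∃ c : ℝ≥0∞, Q.map (multiply a ha) = c • Q

/-- The set of all finite measures of total mass at most `r`. -/
def massBall (X : Type*) [MeasurableSpace X] (r : ℝ) : Set (FiniteMeasure X) :=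
  {μ | (μ.mass : ℝ) ≤ r}

/-! ## Laplace functional on constants and weighted intensity -/

/-- `k_t = ∫ e^{-t μX} dQ(μ)`. -/
def laplaceMass (Q : Measure (FiniteMeasure X)) (t : ℝ) : ℝ≥0∞ :=
  ∫⁻ μ, ENNReal.ofReal (Real.exp (-(t * (μ.mass : ℝ)))) ∂Q

/-- `∫ μ(·) e^{-μX} dQ(μ)`, see `weightedIntensity_apply`. -/
def weightedIntensity (Q : Measure (FiniteMeasure X)) : Measure X :=
  (Q.withDensity fun μ => ENNReal.ofReal (Real.exp (-(μ.mass : ℝ)))).bind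
    fun μ => (μ : Measure X)

theorem weightedIntensity_apply (Q : Measure (FiniteMeasure X)) {A : Set X}
    (hA : MeasurableSet A) :
    weightedIntensity Q A =
      ∫⁻ μ, (μ : Measure X) A * ENNReal.ofReal (Real.exp (-(μ.mass : ℝ))) ∂Q := by
  have hd : Measurable fun μ : FiniteMeasure X => ENNReal.ofReal (Real.exp (-(μ.mass : ℝ))) :=
    (measurable_finiteMeasure_apply MeasurableSet.univ).coe_nnreal_real.neg.exp.ennreal_ofReal
  rw [weightedIntensity, Measure.bind_apply hA measurable_finiteMeasure_coe.aemeasurable]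
  refine (lintegral_withDensity_eq_lintegral_mul _ hd
    ((Measure.measurable_coe hA).comp measurable_finiteMeasure_coe)).trans ?_
  exact lintegral_congr fun μ => mul_comm _ _

/-- The normalization `N(μ) = μ / μX`, with `N(0) = 0`. -/
def normalization (μ : Measure X) : Measure X := (μ Set.univ)⁻¹ • μ

/-! ## The Dirichlet-Ferguson measure -/

/-- The Gamma distribution of shape `a ≥ 0` and rate `1`; shape `0` is the unit mass at `0`. -/
def gammaLaw (a : ℝ) : Measure ℝ := if a = 0 then Measure.dirac 0 else gammaMeasure a 1

/-- The Dirichlet distribution with parameters `a i ≥ 0`, not all zero: the law of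
`(Z i / ∑ j, Z j)_i` for independent `Z i` distributed as `gammaLaw (a i)`. -/
def dirichletLaw {n : ℕ} (a : Fin n → ℝ) : Measure (Fin n → ℝ) :=
  (Measure.pi fun i => gammaLaw (a i)).map fun z i => z i / ∑ j, z j

/-- `D` is the law of a random probability measure on `X` whose evaluations on every finite
measurable partition `(A i)` of `X` follow the Dirichlet distribution with parameters `α (A i)`. -/
structure IsDirichletFerguson (α : Measure X) (D : Measure (ProbabilityMeasure X)) : Prop where
  isProbabilityMeasure : IsProbabilityMeasure D
  map_partition : ∀ (n : ℕ) (A : Fin n → Set X), (∀ i, MeasurableSet (A i)) →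
    Pairwise (fun i j => Disjoint (A i) (A j)) → ⋃ i, A i = Set.univ →
    D.map (fun η i => (η (A i) : ℝ)) = dirichletLaw fun i => (α (A i)).toReal

open Classical in
/-- The Dirichlet-Ferguson measure with intensity `α`: the measure described by
`IsDirichletFerguson α` (and `0` if there were none). -/
def dirichletFerguson (α : Measure X) : Measure (ProbabilityMeasure X) :=
  if h : ∃ D, IsDirichletFerguson α D then h.choose else 0

/-! ## The multiplicative infinite-dimensional Lebesgue measure -/

/-- The measure `t^(θ-1) / Γ(θ) dt` on `(0, ∞)`. -/
def lambdaMeasure (θ : ℝ) : Measure ℝ :=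
  (volume.restrict (Set.Ioi 0)).withDensity
    fun t => ENNReal.ofReal (t ^ (θ - 1) / Real.Gamma θ)

/-- The map `(η, t) ↦ t η`, inverse to `μ ↦ (μ / μX, μX)` for `t > 0`. -/
def scale (p : ProbabilityMeasure X × ℝ) : FiniteMeasure X :=
  p.2.toNNReal • p.1.toFiniteMeasure

theorem measurable_scale : Measurable (scale (X := X)) := by
  refine Measurable.subtype_mk (Measure.measurable_of_measurable_coe _ fun A hA => ?_)
  have h1 : Measurable fun p : ProbabilityMeasure X × ℝ => (p.1 : Measure X) A :=
    (Measure.measurable_coe hA).comp (measurable_subtype_coe.comp measurable_fst)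
  exact (measurable_snd.real_toNNReal.coe_nnreal_ennreal).mul h1

/-- The multiplicative infinite-dimensional Lebesgue measure with shape parameter `θ > 0` and
intensity the probability measure `ν`: the image under `(η, t) ↦ t η` of the product of the
Dirichlet-Ferguson measure with intensity `θ ν` and of `t^(θ-1) / Γ(θ) dt`. -/
def multiplicativeLebesgue (θ : ℝ) (ν : Measure X) : Measure (FiniteMeasure X) :=
  ((dirichletFerguson (ENNReal.ofReal θ • ν)).prod (lambdaMeasure θ)).map scale

end

/-! Write α for the weighted intensity and k_t for the Laplace functional on constants. Multipliers
compose by adding exponents, so the constant by which e^a changes `Q` is a character a ↦ c(a) of the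
additive group of bounded Borel functions. Testing invariance against e^{-μX} identifies it as c(a)
= k_1⁻¹ ∫ e^{-(e^a μ)X} dQ(μ), a value of the Laplace functional of `Q`. Along a = x·1_A the
character is differentiable at x = 0 with derivative -α(A)/k_1, hence equals exp(-x α(A)/k_1)
(`scalingFactor_indicator`).

Taking x = log(1 + t_i) on the cells of a partition turns this into a Laplace transform: under the
probability k_1⁻¹ e^{-μX} dQ(μ), the vector (μA_i) has transform ∏ (1 + t_i)^{-α(A_i)/k_1}, so its
entries are independent Gamma variables (`map_tiltedLaw_partition`). Normalizing this random measure
gives a Dirichlet-Ferguson measure of intensity α/k_1 = θν, which settles existence. Uniqueness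
holds because laws on partitions determine all finite-dimensional evaluations.

To return from the tilted law to `Q`, use constant multipliers: they fix the direction μ/μX and make
`Q` homogeneous of degree θ along rays. Hence, over each Borel set of directions, the law of μX is a
multiple of t^{θ-1} dt, and integrating e^{-t} computes the multiple from the tilted law
(`map_polar_eq`).

The analytic input is k_t < ∞: doubling the radius multiplies the measure of a ball by a fixed
factor, and this geometric growth is beaten by e^{-tμX} (`laplaceMass_lt_top`). -/

/-! ## Laplace transforms on the nonnegative orthant -/

section Laplace

variable {ι : Type*} [Fintype ι]

/-- The bounded continuous function `x ↦ exp (-∑ i, t i * x i)` on the nonnegative orthant. -/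
noncomputable def orthantExp (t : ι → ℝ≥0) : (ι → ℝ≥0) →ᵇ ℝ :=
  BoundedContinuousFunction.ofNormedAddCommGroup
    (fun x => Real.exp (-∑ i, (t i : ℝ) * (x i : ℝ))) (by fun_prop) 1 (fun x => by
      rw [Real.norm_eq_abs, Real.abs_exp, Real.exp_le_one_iff, neg_nonpos]
      positivity)

theorem orthantExp_apply (t : ι → ℝ≥0) (x : ι → ℝ≥0) :
    orthantExp t x = Real.exp (-∑ i, (t i : ℝ) * (x i : ℝ)) := rfl

/-- The multiplicative monoid of the functions `orthantExp t`. -/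
noncomputable def orthantExpMonoid (ι : Type*) [Fintype ι] : Submonoid ((ι → ℝ≥0) →ᵇ ℝ) where
  carrier := Set.range orthantExp
  mul_mem' := by
    rintro _ _ ⟨s, rfl⟩ ⟨t, rfl⟩
    refine ⟨s + t, ?_⟩
    ext x
    simp only [orthantExp_apply, BoundedContinuousFunction.mul_apply, ← Real.exp_add,
      Pi.add_apply, NNReal.coe_add, add_mul, Finset.sum_add_distrib, neg_add]
  one_mem' := ⟨0, by ext x; simp [orthantExp_apply]⟩

/-- The algebra spanned by the functions `orthantExp t`. -/
noncomputable def orthantExpAlgebra (ι : Type*) [Fintype ι] :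
    StarSubalgebra ℝ ((ι → ℝ≥0) →ᵇ ℝ) where
  toSubalgebra := Algebra.adjoin ℝ (orthantExpMonoid ι : Set ((ι → ℝ≥0) →ᵇ ℝ))
  star_mem' := by
    intro a ha
    have : star a = a := by ext x; simp
    rwa [this]

/-- A product of exponentials is an exponential, so the generated algebra is only their linear span.
Equality of integrals therefore passes from exponentials to the whole algebra by linearity alone. -/
theorem mem_orthantExpAlgebra {g : (ι → ℝ≥0) →ᵇ ℝ} :
    g ∈ orthantExpAlgebra ι ↔ g ∈ Submodule.span ℝ (Set.range (orthantExp (ι := ι))) := by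
  change g ∈ Algebra.adjoin ℝ (orthantExpMonoid ι : Set ((ι → ℝ≥0) →ᵇ ℝ)) ↔ _
  rw [← Subalgebra.mem_toSubmodule, Algebra.adjoin_eq_span, Submonoid.closure_eq]
  rfl

/-- Finite measures on the nonnegative orthant are determined by their Laplace transforms. -/
theorem ext_of_laplace {P P' : Measure (ι → ℝ≥0)} [IsFiniteMeasure P] [IsFiniteMeasure P']
    (h : ∀ t : ι → ℝ≥0, ∫ x, Real.exp (-∑ i, (t i : ℝ) * (x i : ℝ)) ∂P =
      ∫ x, Real.exp (-∑ i, (t i : ℝ) * (x i : ℝ)) ∂P') : P = P' := by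
  refine ext_of_forall_mem_subalgebra_integral_eq_of_polish (𝕜 := ℝ)
    (A := orthantExpAlgebra ι) ?_ ?_
  · intro x y hxy
    obtain ⟨i, hi⟩ := Function.ne_iff.1 hxy
    classical
    -- The exponential e^{-x_i} in a coordinate where the two points differ separates them.
    refine ⟨orthantExp (Pi.single i 1), ⟨_, ⟨orthantExp (Pi.single i 1), ?_, rfl⟩, rfl⟩, ?_⟩
    · exact mem_orthantExpAlgebra.2 (Submodule.subset_span ⟨_, rfl⟩)
    · simpa [orthantExp_apply, Pi.single_apply, apply_ite NNReal.toReal] using hi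
  · intro g hg
    rw [mem_orthantExpAlgebra] at hg
    induction hg using Submodule.span_induction with
    | mem g hg =>
      obtain ⟨t, rfl⟩ := hg
      exact h t
    | zero => simp
    | add f g _ _ hf hg =>
      simp only [BoundedContinuousFunction.coe_add, Pi.add_apply]
      rw [integral_add (f.integrable _) (g.integrable _),
        integral_add (f.integrable _) (g.integrable _), hf, hg]
    | smul c f _ hf =>
      simp only [BoundedContinuousFunction.coe_smul, integral_smul, hf]

end Laplace

/-! ## Gamma laws -/

instance isProbabilityMeasure_gammaLaw (a : ℝ≥0) : IsProbabilityMeasure (gammaLaw a) := by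
  unfold gammaLaw
  split_ifs with h
  · infer_instance
  · exact isProbabilityMeasure_gammaMeasure (lt_of_le_of_ne a.2 (Ne.symm h)) one_pos

theorem ae_nonneg_gammaLaw (a : ℝ) : ∀ᵐ x ∂gammaLaw a, 0 ≤ x := by
  unfold gammaLaw
  split_ifs with h
  · rw [ae_dirac_iff measurableSet_Ici]
  · rw [ae_iff]
    simp only [not_le]
    change gammaMeasure a 1 (Set.Iio 0) = 0
    rw [gammaMeasure, withDensity_apply _ measurableSet_Iio, lintegral_gammaPDF_of_nonpos le_rfl]

/-- The factor e^{-sx} changes the rate from 1 to 1 + s in the Gamma integral. Shape 0, the unit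
mass at 0, obeys the same formula, so cells of zero intensity need no separate treatment later. -/
theorem integral_exp_neg_mul_gammaLaw (a : ℝ≥0) {s : ℝ} (hs : 0 ≤ s) :
    ∫ x, Real.exp (-(s * x)) ∂gammaLaw a = (1 + s) ^ (-(a : ℝ)) := by
  unfold gammaLaw
  split_ifs with h
  · simp [h]
  · have ha : 0 < (a : ℝ) := lt_of_le_of_ne a.2 (Ne.symm h)
    have h1 : gammaMeasure (a : ℝ) 1 =
        volume.withDensity fun x => ((gammaPDFReal a 1 x).toNNReal : ℝ≥0∞) := rfl
    rw [h1, integral_withDensity_eq_integral_smul (by fun_prop)]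
    have h2 : ∀ x, (gammaPDFReal a 1 x).toNNReal • Real.exp (-(s * x)) =
        (Set.Ici 0).indicator
          (fun x => (Real.Gamma a)⁻¹ * (x ^ ((a : ℝ) - 1) * Real.exp (-((1 + s) * x)))) x := by
      intro x
      rw [NNReal.smul_def, Real.coe_toNNReal _ (gammaPDFReal_nonneg ha one_pos x), gammaPDFReal,
        Set.indicator]
      simp only [Set.mem_Ici, smul_eq_mul]
      split_ifs
      · rw [show -((1 + s) * x) = -(1 * x) + -(s * x) by ring, Real.exp_add, Real.one_rpow]
        ring
      · simp
    simp_rw [h2]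
    rw [integral_indicator measurableSet_Ici, integral_Ici_eq_integral_Ioi, integral_const_mul,
      Real.integral_rpow_mul_exp_neg_mul_Ioi ha (by positivity), Real.rpow_neg (by positivity),
      one_div, Real.inv_rpow (by positivity)]
    field_simp [(Real.Gamma_pos_of_pos ha).ne']

/-- A random vector in the nonnegative orthant whose Laplace transform is that of independent
Gamma variables has independent Gamma components. -/
theorem map_eq_pi_gammaLaw {ι Ω : Type*} [Fintype ι] [MeasurableSpace Ω] (P : Measure Ω)
    [IsFiniteMeasure P] (a : ι → ℝ≥0) {Y : Ω → ι → ℝ≥0} (hY : Measurable Y)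
    (h : ∀ t : ι → ℝ≥0, ∫ ω, Real.exp (-∑ i, (t i : ℝ) * (Y ω i : ℝ)) ∂P =
      ∏ i, (1 + (t i : ℝ)) ^ (-(a i : ℝ))) :
    P.map (fun ω i => (Y ω i : ℝ)) = Measure.pi fun i => gammaLaw (a i) := by
  have hT : Measurable fun (x : ι → ℝ) i => (x i).toNNReal :=
    measurable_pi_lambda _ fun i => (measurable_pi_apply i).real_toNNReal
  have hc : Measurable fun (x : ι → ℝ≥0) i => (x i : ℝ) :=
    measurable_pi_lambda _ fun i => (measurable_pi_apply i).coe_nnreal_real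
  have hnn : ∀ᵐ x ∂(Measure.pi fun i => gammaLaw (a i)), ∀ i, 0 ≤ x i := by
    rw [ae_all_iff]
    intro i
    exact (Measure.tendsto_eval_ae_ae (μ := fun i => gammaLaw (a i))).eventually
      (ae_nonneg_gammaLaw (a i))
  -- The Gamma laws live on ℝ, but uniqueness of Laplace transforms is available on the nonnegative
  -- orthant. Truncating by `Real.toNNReal` changes nothing almost everywhere.
  have key : P.map Y = (Measure.pi fun i => gammaLaw (a i)).map fun x i => (x i).toNNReal := by
    have := Measure.isFiniteMeasure_map P Y
    have := Measure.isFiniteMeasure_map (Measure.pi fun i => gammaLaw (a i))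
      (fun (x : ι → ℝ) i => (x i).toNNReal)
    refine ext_of_laplace fun t => ?_
    have hm : Continuous fun x : ι → ℝ≥0 => Real.exp (-∑ i, (t i : ℝ) * (x i : ℝ)) := by fun_prop
    rw [integral_map hY.aemeasurable hm.aestronglyMeasurable, h,
      integral_map hT.aemeasurable hm.aestronglyMeasurable]
    have h1 : ∀ᵐ x ∂(Measure.pi fun i => gammaLaw (a i)),
        Real.exp (-∑ i, (t i : ℝ) * ((x i).toNNReal : ℝ)) = ∏ i, Real.exp (-(t i * x i)) := by
      filter_upwards [hnn] with x hx
      rw [← Finset.sum_neg_distrib, Real.exp_sum]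
      refine Finset.prod_congr rfl fun i _ => ?_
      rw [Real.coe_toNNReal _ (hx i)]
    rw [integral_congr_ae h1,
      integral_fintype_prod_eq_prod (fun i (x : ℝ) => Real.exp (-((t i : ℝ) * x)))]
    exact Finset.prod_congr rfl fun i _ => (integral_exp_neg_mul_gammaLaw _ (t i).2).symm
  have h2 : P.map (fun ω i => (Y ω i : ℝ)) = (P.map Y).map fun x i => (x i : ℝ) := by
    rw [Measure.map_map hc hY]; rfl
  rw [h2, key, Measure.map_map hc hT]
  conv_rhs => rw [← Measure.map_id (μ := Measure.pi fun i => gammaLaw (a i))]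
  refine Measure.map_congr ?_
  filter_upwards [hnn] with x hx
  ext i
  simp [hx i]

/-! ## Multipliers -/

section Multipliers

variable {X : Type*} [MeasurableSpace X]

theorem IsBddBorel.const (x : ℝ) : IsBddBorel fun _ : X => x :=
  ⟨measurable_const, |x|, fun _ => le_rfl⟩

theorem IsBddBorel.add {a b : X → ℝ} (ha : IsBddBorel a) (hb : IsBddBorel b) :
    IsBddBorel (a + b) := by
  obtain ⟨C, hC⟩ := ha.bounded
  obtain ⟨D, hD⟩ := hb.bounded
  exact ⟨ha.measurable.add hb.measurable, C + D, fun x =>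
    (abs_add_le _ _).trans (add_le_add (hC x) (hD x))⟩

theorem IsBddBorel.indicator_const {A : Set X} (hA : MeasurableSet A) (x : ℝ) :
    IsBddBorel (A.indicator fun _ => x) := by
  refine ⟨measurable_const.indicator hA, |x|, fun y => ?_⟩
  by_cases hy : y ∈ A <;> simp [hy]

theorem IsBddBorel.sum {ι : Type*} (s : Finset ι) {a : ι → X → ℝ}
    (ha : ∀ i, IsBddBorel (a i)) : IsBddBorel (∑ i ∈ s, a i) := by
  classical
  induction s using Finset.induction_on with
  | empty => exact IsBddBorel.const 0
  | insert i s hi ih => rw [Finset.sum_insert hi]; exact (ha i).add ih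

theorem toMeasure_multiply {a : X → ℝ} (ha : IsBddBorel a) (μ : FiniteMeasure X) :
    (multiply a ha μ : Measure X) =
      (μ : Measure X).withDensity fun x => ENNReal.ofReal (Real.exp (a x)) := rfl

theorem ennreal_mass_multiply {a : X → ℝ} (ha : IsBddBorel a) (μ : FiniteMeasure X) :
    ((multiply a ha μ).mass : ℝ≥0∞) = ∫⁻ x, ENNReal.ofReal (Real.exp (a x)) ∂(μ : Measure X) := by
  rw [FiniteMeasure.ennreal_mass, toMeasure_multiply, withDensity_apply _ MeasurableSet.univ,
    Measure.restrict_univ]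

theorem multiply_add {a b : X → ℝ} (ha : IsBddBorel a) (hb : IsBddBorel b)
    (hab : IsBddBorel (a + b)) : multiply (a + b) hab = multiply a ha ∘ multiply b hb := by
  funext μ
  apply FiniteMeasure.toMeasure_injective
  rw [Function.comp_apply, toMeasure_multiply, toMeasure_multiply, toMeasure_multiply,
    ← withDensity_mul _ hb.measurable.exp.ennreal_ofReal ha.measurable.exp.ennreal_ofReal]
  congr 1
  ext x
  rw [Pi.mul_apply, ← ENNReal.ofReal_mul (Real.exp_pos _).le, ← Real.exp_add, Pi.add_apply,
    add_comm]

theorem multiply_zero (h : IsBddBorel (0 : X → ℝ)) : multiply 0 h = id := by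
  funext μ
  apply FiniteMeasure.toMeasure_injective
  rw [toMeasure_multiply]
  simp

theorem multiply_const (x : ℝ) (μ : FiniteMeasure X) :
    multiply (fun _ => x) (IsBddBorel.const x) μ = (Real.exp x).toNNReal • μ := by
  apply FiniteMeasure.toMeasure_injective
  rw [toMeasure_multiply, withDensity_const]
  rfl

theorem mass_multiply_const (x : ℝ) (μ : FiniteMeasure X) :
    ((multiply (fun _ => x) (IsBddBorel.const x) μ).mass : ℝ) = Real.exp x * μ.mass := by
  rw [multiply_const]
  change (((Real.exp x).toNNReal • μ) Set.univ : ℝ) = _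
  rw [FiniteMeasure.smul_apply]
  simp [FiniteMeasure.mass, (Real.exp_pos x).le]

/-- This bounds the Laplace functional at `a` by k_t with t = e^{-C}, which is why k_t must be
finite for all t > 0 and not only for t = 1. -/
theorem exp_neg_mul_mass_le_mass_multiply {a : X → ℝ} (ha : IsBddBorel a) {C : ℝ}
    (hC : ∀ x, |a x| ≤ C) (μ : FiniteMeasure X) :
    Real.exp (-C) * μ.mass ≤ (multiply a ha μ).mass := by
  have h : ENNReal.ofReal (Real.exp (-C)) * μ.mass ≤ (multiply a ha μ).mass := by
    rw [ennreal_mass_multiply, FiniteMeasure.ennreal_mass, ← lintegral_const]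
    exact lintegral_mono fun x =>
      ENNReal.ofReal_le_ofReal (Real.exp_le_exp.2 (neg_le_of_abs_le (hC x)))
  have := ENNReal.toReal_mono ENNReal.coe_ne_top h
  rwa [ENNReal.toReal_mul, ENNReal.toReal_ofReal (Real.exp_pos _).le, ENNReal.coe_toReal,
    ENNReal.coe_toReal] at this

/-- Step functions turn the total mass into an arbitrary positive combination of the masses of the
cells: this is how scaling factors become joint Laplace transforms. -/
theorem mass_multiply_sum_indicator {ι : Type*} [Fintype ι] {A : ι → Set X}
    (hA : ∀ i, MeasurableSet (A i)) (hd : Pairwise fun i j => Disjoint (A i) (A j))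
    (hU : ⋃ i, A i = Set.univ) (x : ι → ℝ)
    (h : IsBddBorel (∑ i, (A i).indicator fun _ => x i)) (μ : FiniteMeasure X) :
    ((multiply (∑ i, (A i).indicator fun _ => x i) h μ).mass : ℝ) =
      ∑ i, Real.exp (x i) * μ (A i) := by
  have hval : ∀ i, ∀ y ∈ A i, (∑ j, (A j).indicator fun _ => x j) y = x i := by
    intro i y hy
    rw [Finset.sum_apply, Finset.sum_eq_single i]
    · simp [hy]
    · intro j _ hji
      exact Set.indicator_of_notMem (fun hj => Set.disjoint_left.1 (hd hji) hj hy) _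
    · simp
  have key : ((multiply (∑ i, (A i).indicator fun _ => x i) h μ).mass : ℝ≥0∞) =
      ∑ i, ENNReal.ofReal (Real.exp (x i)) * μ (A i) := by
    rw [ennreal_mass_multiply, ← setLIntegral_univ, ← hU, lintegral_iUnion hA hd, tsum_fintype]
    refine Finset.sum_congr rfl fun i _ => ?_
    rw [setLIntegral_congr_fun (g := fun _ => ENNReal.ofReal (Real.exp (x i))) (hA i)
      (fun y hy => by simp only [hval i y hy]), setLIntegral_const,
      FiniteMeasure.ennreal_coeFn_eq_coeFn_toMeasure]
  have := congrArg ENNReal.toReal key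
  simp only [ENNReal.toReal_sum (fun i _ => ENNReal.mul_ne_top ENNReal.ofReal_ne_top
    ENNReal.coe_ne_top), ENNReal.toReal_mul, ENNReal.toReal_ofReal (Real.exp_pos _).le,
    ENNReal.coe_toReal] at this
  exact this

theorem measurable_mass : Measurable fun μ : FiniteMeasure X => μ.mass :=
  measurable_finiteMeasure_apply MeasurableSet.univ

theorem measurableSet_massBall (r : ℝ) : MeasurableSet (massBall X r) :=
  measurableSet_le measurable_mass.coe_nnreal_real measurable_const

end Multipliers

/-! ## Finiteness of the Laplace functional on constants -/

section LaplaceMass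

variable {X : Type*} [MeasurableSpace X] {Q : Measure (FiniteMeasure X)}

theorem ne_zero_of_map_multiply_eq (hQ : Q ≠ 0) {a : X → ℝ} (ha : IsBddBorel a) {c : ℝ≥0∞}
    (h : Q.map (multiply a ha) = c • Q) : c ≠ 0 := by
  rintro rfl
  rw [zero_smul, Measure.map_eq_zero_iff (measurable_multiply a ha).aemeasurable] at h
  exact hQ h

/-- Doubling the radius multiplies the measure of balls by a finite constant. -/
theorem exists_measure_massBall_two_pow (hQ : Q ≠ 0) (hinv : IsProjectivelyInvariant Q)
    {r : ℝ} (hr : 0 < r) (h0 : 0 < Q (massBall X r)) (h1 : Q (massBall X r) < ∞) :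
    ∃ K : ℝ, 0 < K ∧ ∀ n : ℕ,
      Q (massBall X (r * 2 ^ n)) = ENNReal.ofReal K ^ n * Q (massBall X r) := by
  obtain ⟨c, hc⟩ := hinv _ (IsBddBorel.const (X := X) (Real.log 2))
  have hstep : ∀ ρ : ℝ, Q (massBall X ρ) = c * Q (massBall X (ρ * 2)) := by
    intro ρ
    have h := congrArg (fun m : Measure (FiniteMeasure X) => m (massBall X (ρ * 2))) hc
    simp only [Measure.smul_apply, smul_eq_mul] at h
    rw [Measure.map_apply (measurable_multiply _ _) (measurableSet_massBall _)] at h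
    rw [← h]
    congr 1
    ext μ
    simp only [massBall, Set.mem_preimage, Set.mem_ofPred_eq, mass_multiply_const,
      Real.exp_log two_pos]
    constructor <;> intro h <;> linarith
  have hc0 : c ≠ 0 := ne_zero_of_map_multiply_eq hQ _ hc
  -- An infinite factor would force the ball of radius `r` to have infinite measure, since the ball
  -- of radius 2r has positive measure.
  have hcT : c ≠ ∞ := by
    rintro rfl
    have hpos : Q (massBall X (r * 2)) ≠ 0 := by
      refine (h0.trans_le (measure_mono fun μ hμ => ?_)).ne'
      exact le_trans (b := r) hμ (by linarith)
    rw [hstep r, ENNReal.top_mul hpos] at h1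
    exact lt_irrefl _ h1
  have hci : ENNReal.ofReal (c⁻¹).toReal = c⁻¹ := ENNReal.ofReal_toReal (ENNReal.inv_ne_top.2 hc0)
  refine ⟨(c⁻¹).toReal, ENNReal.toReal_pos (ENNReal.inv_ne_zero.2 hcT)
    (ENNReal.inv_ne_top.2 hc0), fun n => ?_⟩
  rw [hci]
  induction n with
  | zero => simp
  | succ n ih =>
    rw [pow_succ' c⁻¹, mul_assoc c⁻¹, ← ih, hstep (r * 2 ^ n), ← mul_assoc c⁻¹,
      ENNReal.inv_mul_cancel hc0 hcT, one_mul, pow_succ, mul_assoc r]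

/-- The ratio of consecutive terms is K e^{-c 2^n}, which tends to 0. -/
theorem summable_exp_neg_two_pow {c K : ℝ} (hc : 0 < c) (hK : 0 < K) :
    Summable fun n : ℕ => Real.exp (-(c * 2 ^ n)) * K ^ (n + 1) := by
  refine summable_of_ratio_test_tendsto_lt_one (l := 0) one_pos
    (Eventually.of_forall fun n => by positivity) ?_
  have h : ∀ n : ℕ, ‖Real.exp (-(c * 2 ^ (n + 1))) * K ^ (n + 1 + 1)‖ /
      ‖Real.exp (-(c * 2 ^ n)) * K ^ (n + 1)‖ = K * Real.exp (-(c * 2 ^ n)) := by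
    intro n
    rw [Real.norm_of_nonneg (by positivity), Real.norm_of_nonneg (by positivity),
      div_eq_iff (by positivity), show -(c * 2 ^ (n + 1)) = -(c * 2 ^ n) + -(c * 2 ^ n) by ring,
      Real.exp_add]
    ring
  simp_rw [h]
  rw [← mul_zero K]
  refine Tendsto.const_mul K (Real.tendsto_exp_neg_atTop_nhds_zero.comp ?_)
  exact (tendsto_pow_atTop_atTop_of_one_lt one_lt_two).const_mul_atTop hc

theorem laplaceMass_lt_top (hQ : Q ≠ 0) (hinv : IsProjectivelyInvariant Q)
    {r : ℝ} (hr : 0 < r) (h0 : 0 < Q (massBall X r)) (h1 : Q (massBall X r) < ∞)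
    {t : ℝ} (ht : 0 < t) : laplaceMass Q t < ∞ := by
  obtain ⟨K, hK, hKn⟩ := exists_measure_massBall_two_pow hQ hinv hr h0 h1
  -- Dyadic shells: for r 2^n ≤ μX < r 2^(n+1) the integrand is at most e^{-t r 2^n}, and the shell
  -- lies in the ball of radius r 2^(n+1).
  have hpt : ∀ μ : FiniteMeasure X, ENNReal.ofReal (Real.exp (-(t * (μ.mass : ℝ)))) ≤
      (massBall X r).indicator 1 μ + ∑' n : ℕ, (massBall X (r * 2 ^ (n + 1))).indicator
        (fun _ => ENNReal.ofReal (Real.exp (-(t * r * 2 ^ n)))) μ := by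
    intro μ
    by_cases hμ : (μ.mass : ℝ) ≤ r
    · refine le_add_right ?_
      rw [Set.indicator_of_mem (show μ ∈ massBall X r from hμ), Pi.one_apply,
        ENNReal.ofReal_le_one, Real.exp_le_one_iff, neg_nonpos]
      positivity
    · refine le_add_left ?_
      obtain ⟨n, hn1, hn2⟩ := exists_nat_pow_near
        ((one_le_div hr).2 (not_le.1 hμ).le) one_lt_two
      rw [le_div_iff₀ hr] at hn1
      rw [div_lt_iff₀ hr] at hn2
      refine le_trans ?_ (ENNReal.le_tsum n)
      rw [Set.indicator_of_mem (show μ ∈ massBall X (r * 2 ^ (n + 1)) from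
        hn2.le.trans_eq (mul_comm _ _))]
      refine ENNReal.ofReal_le_ofReal (Real.exp_le_exp.2 (neg_le_neg ?_))
      rw [mul_assoc, mul_comm r]
      exact mul_le_mul_of_nonneg_left hn1 ht.le
  refine (lintegral_mono hpt).trans_lt ?_
  rw [lintegral_add_left (measurable_one.indicator (measurableSet_massBall r)),
    lintegral_indicator_one (measurableSet_massBall r),
    lintegral_tsum fun n => (measurable_const.indicator (measurableSet_massBall _)).aemeasurable]
  refine ENNReal.add_lt_top.2 ⟨h1, ?_⟩
  have h2 : ∀ n : ℕ, ∫⁻ μ, (massBall X (r * 2 ^ (n + 1))).indicator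
      (fun _ => ENNReal.ofReal (Real.exp (-(t * r * 2 ^ n)))) μ ∂Q =
      ENNReal.ofReal (Real.exp (-(t * r * 2 ^ n)) * K ^ (n + 1)) * Q (massBall X r) := by
    intro n
    rw [lintegral_indicator_const (measurableSet_massBall _), hKn, ← mul_assoc,
      ENNReal.ofReal_mul (Real.exp_pos _).le, ENNReal.ofReal_pow hK.le]
  simp_rw [h2]
  rw [ENNReal.tsum_mul_right]
  exact ENNReal.mul_lt_top (summable_exp_neg_two_pow (mul_pos ht hr) hK).tsum_ofReal_lt_top h1

theorem laplaceMass_pos (hQ : Q ≠ 0) (t : ℝ) : 0 < laplaceMass Q t := by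
  rw [laplaceMass, lintegral_pos_iff_support (by have := measurable_mass (X := X); fun_prop)]
  have : Function.support (fun μ : FiniteMeasure X =>
      ENNReal.ofReal (Real.exp (-(t * (μ.mass : ℝ))))) = Set.univ := by
    ext μ
    simp [Real.exp_pos]
  rw [this]
  exact pos_iff_ne_zero.2 (mt Measure.measure_univ_eq_zero.1 hQ)

end LaplaceMass

/-! ## The scaling factors of multipliers -/

section ScalingFactor

variable {X : Type*} [MeasurableSpace X] {Q : Measure (FiniteMeasure X)}

theorem measurable_exp_neg_mul_mass (t : ℝ) :
    Measurable fun μ : FiniteMeasure X => Real.exp (-(t * (μ.mass : ℝ))) :=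
  (measurable_mass.coe_nnreal_real.const_mul t).neg.exp

theorem measurable_exp_neg_mass :
    Measurable fun μ : FiniteMeasure X => Real.exp (-(μ.mass : ℝ)) :=
  measurable_mass.coe_nnreal_real.neg.exp

theorem integrable_exp_neg_mul_mass {t : ℝ} (h : laplaceMass Q t < ∞) :
    Integrable (fun μ : FiniteMeasure X => Real.exp (-(t * (μ.mass : ℝ)))) Q := by
  refine ⟨(measurable_exp_neg_mul_mass t).aestronglyMeasurable, ?_⟩
  rw [hasFiniteIntegral_iff_ofReal (Eventually.of_forall fun μ => (Real.exp_pos _).le)]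
  exact h

theorem integral_exp_neg_mul_mass (t : ℝ) :
    ∫ μ : FiniteMeasure X, Real.exp (-(t * (μ.mass : ℝ))) ∂Q = (laplaceMass Q t).toReal :=
  integral_eq_lintegral_of_nonneg_ae (Eventually.of_forall fun _ => (Real.exp_pos _).le)
    (measurable_exp_neg_mul_mass t).aestronglyMeasurable

theorem integral_exp_neg_mass :
    ∫ μ : FiniteMeasure X, Real.exp (-(μ.mass : ℝ)) ∂Q = (laplaceMass Q 1).toReal := by
  simpa using integral_exp_neg_mul_mass (Q := Q) 1

theorem integrable_exp_neg_mass (h : laplaceMass Q 1 < ∞) :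
    Integrable (fun μ : FiniteMeasure X => Real.exp (-(μ.mass : ℝ))) Q := by
  simpa using integrable_exp_neg_mul_mass h

/-- The factor by which the multiplier `e^a` changes `Q`. -/
noncomputable def scalingFactor (Q : Measure (FiniteMeasure X)) (a : X → ℝ)
    (ha : IsBddBorel a) : ℝ :=
  (∫ μ, Real.exp (-((multiply a ha μ).mass : ℝ)) ∂Q) / (laplaceMass Q 1).toReal

/-- Integrating e^{-μX} against both sides of the invariance relation gives the unknown constant as
a quotient by k_1. It is finite because the numerator is at most k_t for a suitable t > 0. -/
theorem map_multiply_eq (hQ : Q ≠ 0) (hinv : IsProjectivelyInvariant Q)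
    (hfin : ∀ t : ℝ, 0 < t → laplaceMass Q t < ∞) {a : X → ℝ} (ha : IsBddBorel a) :
    Q.map (multiply a ha) = ENNReal.ofReal (scalingFactor Q a ha) • Q := by
  obtain ⟨c, hc⟩ := hinv a ha
  have hk0 := laplaceMass_pos hQ 1
  have hkT := hfin 1 one_pos
  have hm := measurable_exp_neg_mass (X := X)
  have h1 : ∫⁻ μ, ENNReal.ofReal (Real.exp (-((multiply a ha μ).mass : ℝ))) ∂Q =
      c * laplaceMass Q 1 := by
    rw [← lintegral_map (f := fun μ : FiniteMeasure X => ENNReal.ofReal (Real.exp (-(μ.mass : ℝ))))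
      hm.ennreal_ofReal (measurable_multiply a ha), hc, lintegral_smul_measure, laplaceMass]
    simp
  have hcT : c ≠ ∞ := by
    obtain ⟨C, hC⟩ := ha.bounded
    rintro rfl
    rw [ENNReal.top_mul hk0.ne'] at h1
    refine (lt_of_le_of_lt ?_ (hfin (Real.exp (-C)) (Real.exp_pos _))).ne h1
    exact lintegral_mono fun μ => ENNReal.ofReal_le_ofReal
      (Real.exp_le_exp.2 (neg_le_neg (exp_neg_mul_mass_le_mass_multiply ha hC μ)))
  have h2 : scalingFactor Q a ha = c.toReal := by
    rw [scalingFactor, integral_eq_lintegral_of_nonneg_ae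
      (Eventually.of_forall fun μ => (Real.exp_pos _).le)
      (hm.comp (measurable_multiply a ha)).aestronglyMeasurable, h1, ENNReal.toReal_mul,
      mul_div_assoc, div_self (ENNReal.toReal_pos hk0.ne' hkT.ne).ne', mul_one]
  rw [h2, ENNReal.ofReal_toReal hcT, hc]

theorem integral_exp_neg_mass_multiply (hQ : Q ≠ 0)
    (hfin : ∀ t : ℝ, 0 < t → laplaceMass Q t < ∞) {a : X → ℝ} (ha : IsBddBorel a) :
    ∫ μ, Real.exp (-((multiply a ha μ).mass : ℝ)) ∂Q =
      scalingFactor Q a ha * (laplaceMass Q 1).toReal := by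
  rw [scalingFactor, div_mul_cancel₀ _
    (ENNReal.toReal_pos (laplaceMass_pos hQ 1).ne' (hfin 1 one_pos).ne).ne']

theorem scalingFactor_nonneg {a : X → ℝ} (ha : IsBddBorel a) : 0 ≤ scalingFactor Q a ha :=
  div_nonneg (integral_nonneg fun _ => (Real.exp_pos _).le) ENNReal.toReal_nonneg

theorem scalingFactor_zero (hQ : Q ≠ 0) (hfin : ∀ t : ℝ, 0 < t → laplaceMass Q t < ∞)
    (h : IsBddBorel (0 : X → ℝ)) : scalingFactor Q 0 h = 1 := by
  rw [scalingFactor, multiply_zero]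
  simp only [id]
  rw [integral_exp_neg_mass, div_self
    (ENNReal.toReal_pos (laplaceMass_pos hQ 1).ne' (hfin 1 one_pos).ne).ne']

/-- Transporting the integral along the multiplier of `b` costs the factor of `b` and leaves the
integral that defines the factor of `a`. -/
theorem scalingFactor_add (hQ : Q ≠ 0) (hinv : IsProjectivelyInvariant Q)
    (hfin : ∀ t : ℝ, 0 < t → laplaceMass Q t < ∞) {a b : X → ℝ} (ha : IsBddBorel a)
    (hb : IsBddBorel b) (hab : IsBddBorel (a + b)) :
    scalingFactor Q (a + b) hab = scalingFactor Q a ha * scalingFactor Q b hb := by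
  have hm : Measurable fun μ : FiniteMeasure X => Real.exp (-((multiply a ha μ).mass : ℝ)) :=
    (measurable_mass.comp (measurable_multiply a ha)).coe_nnreal_real.neg.exp
  have h := integral_map (measurable_multiply b hb).aemeasurable (μ := Q)
    (f := fun μ : FiniteMeasure X => Real.exp (-((multiply a ha μ).mass : ℝ)))
    hm.aestronglyMeasurable
  rw [map_multiply_eq hQ hinv hfin hb, integral_smul_measure,
    ENNReal.toReal_ofReal (scalingFactor_nonneg hb)] at h
  rw [scalingFactor, multiply_add ha hb hab]
  simp only [Function.comp_apply]
  rw [← h, smul_eq_mul, mul_div_assoc, ← scalingFactor, mul_comm]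

theorem scalingFactor_sum (hQ : Q ≠ 0) (hinv : IsProjectivelyInvariant Q)
    (hfin : ∀ t : ℝ, 0 < t → laplaceMass Q t < ∞) {ι : Type*} (s : Finset ι) {a : ι → X → ℝ}
    (ha : ∀ i, IsBddBorel (a i)) (h : IsBddBorel (∑ i ∈ s, a i)) :
    scalingFactor Q (∑ i ∈ s, a i) h = ∏ i ∈ s, scalingFactor Q (a i) (ha i) := by
  classical
  induction s using Finset.induction_on with
  | empty => simpa using scalingFactor_zero hQ hfin _
  | insert i s hi ih =>
    rw [Finset.prod_insert hi, ← ih (IsBddBorel.sum s ha),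
      ← scalingFactor_add hQ hinv hfin (ha i) (IsBddBorel.sum s ha)
        ((ha i).add (IsBddBorel.sum s ha))]
    congr 1
    exact Finset.sum_insert hi

theorem mass_multiply_indicator {A : Set X} (hA : MeasurableSet A) (x : ℝ)
    (μ : FiniteMeasure X) :
    ((multiply (A.indicator fun _ => x) (IsBddBorel.indicator_const hA x) μ).mass : ℝ) =
      μ Aᶜ + Real.exp x * μ A := by
  have key : ((multiply (A.indicator fun _ => x) (IsBddBorel.indicator_const hA x) μ).mass : ℝ≥0∞)
      = μ Aᶜ + ENNReal.ofReal (Real.exp x) * μ A := by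
    rw [ennreal_mass_multiply, ← lintegral_add_compl _ hA, add_comm,
      setLIntegral_congr_fun (g := fun _ => ENNReal.ofReal (Real.exp x)) hA
      (fun y hy => by simp only [Set.indicator_of_mem hy]), setLIntegral_const,
      setLIntegral_congr_fun (g := fun _ => 1) hA.compl
      (fun y hy => by simp [Set.indicator_of_notMem hy]), setLIntegral_const, one_mul,
      FiniteMeasure.ennreal_coeFn_eq_coeFn_toMeasure,
      FiniteMeasure.ennreal_coeFn_eq_coeFn_toMeasure]
  have := congrArg ENNReal.toReal key
  rwa [ENNReal.toReal_add ENNReal.coe_ne_top (ENNReal.mul_ne_top ENNReal.ofReal_ne_top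
    ENNReal.coe_ne_top), ENNReal.toReal_mul, ENNReal.toReal_ofReal (Real.exp_pos _).le,
    ENNReal.coe_toReal, ENNReal.coe_toReal, ENNReal.coe_toReal] at this

theorem apply_add_apply_compl {A : Set X} (hA : MeasurableSet A) (μ : FiniteMeasure X) :
    (μ A : ℝ) + μ Aᶜ = μ.mass := by
  have h := measure_add_measure_compl (μ := (μ : Measure X)) hA
  rw [← FiniteMeasure.ennreal_coeFn_eq_coeFn_toMeasure,
    ← FiniteMeasure.ennreal_coeFn_eq_coeFn_toMeasure, ← FiniteMeasure.ennreal_mass] at h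
  exact_mod_cast h

/-- Half of the exponential decay absorbs the linear factor, and the other half remains integrable
against `Q`. -/
theorem mul_exp_neg_le {δ m : ℝ} (hδ : 0 < δ) :
    m * Real.exp (-(δ * m)) ≤ 2 / δ * Real.exp (-(δ / 2 * m)) := by
  have h : δ / 2 * m ≤ Real.exp (δ / 2 * m) := (le_add_of_nonneg_right zero_le_one).trans
    (Real.add_one_le_exp _)
  rw [show -(δ * m) = -(δ / 2 * m) + -(δ / 2 * m) by ring, Real.exp_add, ← mul_assoc]
  refine mul_le_mul_of_nonneg_right ?_ (Real.exp_pos _).le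
  calc m * Real.exp (-(δ / 2 * m)) = 2 / δ * (δ / 2 * m) * Real.exp (-(δ / 2 * m)) := by
        field_simp
    _ ≤ 2 / δ * Real.exp (δ / 2 * m) * Real.exp (-(δ / 2 * m)) := by gcongr
    _ = 2 / δ := by rw [mul_assoc, ← Real.exp_add]; simp

/-- Differentiation under the integral brings down -μA e^{-μX} at x = 0, so the intensity enters as
the derivative of the character. -/
theorem hasDerivAt_scalingFactor_indicator (hfin : ∀ t : ℝ, 0 < t → laplaceMass Q t < ∞)
    {A : Set X} (hA : MeasurableSet A) :
    HasDerivAt (fun x : ℝ =>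
        scalingFactor Q (A.indicator fun _ => x) (IsBddBorel.indicator_const hA x))
      (-(∫ μ : FiniteMeasure X, (μ A : ℝ) * Real.exp (-(μ.mass : ℝ)) ∂Q) /
        (laplaceMass Q 1).toReal) 0 := by
  simp only [scalingFactor, mass_multiply_indicator hA]
  refine HasDerivAt.div_const ?_ _
  have hmA : Measurable fun μ : FiniteMeasure X => (μ A : ℝ) :=
    (measurable_finiteMeasure_apply hA).coe_nnreal_real
  have hmAc : Measurable fun μ : FiniteMeasure X => (μ Aᶜ : ℝ) :=
    (measurable_finiteMeasure_apply hA.compl).coe_nnreal_real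
  -- For |x| < 1 one has e^x ≥ e^{-1} = δ, so the perturbed mass is at least δ μX. This gives a
  -- dominating function independent of x.
  set δ : ℝ := Real.exp (-1) with hδ
  have hδ0 : 0 < δ := Real.exp_pos _
  have key := hasDerivAt_integral_of_dominated_loc_of_deriv_le (μ := Q) (x₀ := (0 : ℝ))
    (F := fun (x : ℝ) (μ : FiniteMeasure X) => Real.exp (-((μ Aᶜ : ℝ) + Real.exp x * μ A)))
    (F' := fun (x : ℝ) (μ : FiniteMeasure X) =>
      Real.exp (-((μ Aᶜ : ℝ) + Real.exp x * μ A)) * -(Real.exp x * μ A))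
    (bound := fun μ => Real.exp 1 * (2 / δ * Real.exp (-(δ / 2 * (μ.mass : ℝ)))))
    (s := Metric.ball 0 1) (Metric.ball_mem_nhds 0 one_pos)
    (Eventually.of_forall fun x => (hmAc.add (hmA.const_mul _)).neg.exp.aestronglyMeasurable)
    ?_ ((hmAc.add (hmA.const_mul _)).neg.exp.mul (hmA.const_mul _).neg).aestronglyMeasurable
    ?_ ?_ ?_
  · convert! key.2 using 1
    rw [← integral_neg]
    refine integral_congr_ae (Eventually.of_forall fun μ => ?_)
    simp only [Real.exp_zero, one_mul, ← apply_add_apply_compl hA μ]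
    rw [add_comm (μ A : ℝ)]
    ring
  · have h1 := integrable_exp_neg_mass (hfin 1 one_pos)
    refine h1.congr (Eventually.of_forall fun μ => ?_)
    simp only [Real.exp_zero, one_mul, ← apply_add_apply_compl hA μ, add_comm]
  · refine Eventually.of_forall fun μ x hx => ?_
    rw [Metric.mem_ball, dist_zero_right, Real.norm_eq_abs, abs_lt] at hx
    have hA0 : (0 : ℝ) ≤ μ A := NNReal.coe_nonneg _
    have hAc0 : (0 : ℝ) ≤ μ Aᶜ := NNReal.coe_nonneg _
    have hAm : (μ A : ℝ) ≤ μ.mass := by linarith [apply_add_apply_compl hA μ]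
    have hx1 : Real.exp x ≤ Real.exp 1 := Real.exp_le_exp.2 hx.2.le
    have hx2 : δ ≤ Real.exp x := Real.exp_le_exp.2 hx.1.le
    have hδ1 : δ ≤ 1 := by rw [hδ, Real.exp_le_one_iff]; norm_num
    rw [norm_mul, norm_neg, Real.norm_of_nonneg (Real.exp_pos _).le,
      Real.norm_of_nonneg (by positivity)]
    calc Real.exp (-((μ Aᶜ : ℝ) + Real.exp x * μ A)) * (Real.exp x * μ A)
        ≤ Real.exp (-(δ * μ.mass)) * (Real.exp 1 * μ.mass) := by
          gcongr
          rw [← apply_add_apply_compl hA μ]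
          nlinarith
      _ = Real.exp 1 * (μ.mass * Real.exp (-(δ * μ.mass))) := by ring
      _ ≤ _ := by
          exact mul_le_mul_of_nonneg_left (mul_exp_neg_le hδ0) (Real.exp_pos 1).le
  · exact ((integrable_exp_neg_mul_mass (hfin (δ / 2) (by positivity))).const_mul _).const_mul _
  · refine Eventually.of_forall fun μ x _ => ?_
    exact ((((Real.hasDerivAt_exp x).mul_const (μ A : ℝ)).const_add (μ Aᶜ : ℝ)).neg).exp

/-- A multiplicative function on the line which is differentiable at `0` is an exponential. -/
theorem eq_exp_of_map_add_of_hasDerivAt_zero {φ : ℝ → ℝ} {d : ℝ} (h0 : φ 0 = 1)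
    (hadd : ∀ x y, φ (x + y) = φ x * φ y) (hd : HasDerivAt φ d 0) (x : ℝ) :
    φ x = Real.exp (d * x) := by
  have hderiv : ∀ y, HasDerivAt φ (φ y * d) y := by
    intro y
    -- Multiplicativity carries the derivative at 0 to every point, giving φ' = dφ.
    have h1 : φ = fun z => φ y * φ (z - y) := by
      funext z
      rw [← hadd, add_sub_cancel]
    have h2 : HasDerivAt (fun z => φ (z - y)) d y := by
      refine HasDerivAt.comp_sub_const (f := φ) y y ?_
      rwa [sub_self]
    rw [h1]
    simpa [h0] using h2.const_mul (φ y)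
  have hconst : ∀ y, HasDerivAt (fun z => φ z * Real.exp (-(d * z))) 0 y := by
    intro y
    have h1 : HasDerivAt (fun z => Real.exp (-(d * z))) (Real.exp (-(d * y)) * -(d * 1)) y :=
      (((hasDerivAt_id y).const_mul d).neg).exp
    convert! (hderiv y).mul h1 using 1
    ring
  have := is_const_of_deriv_eq_zero (fun y => (hconst y).differentiableAt)
    (fun y => (hconst y).deriv) x 0
  simp only [mul_zero, neg_zero, Real.exp_zero, mul_one, h0] at this
  rw [Real.exp_neg, ← div_eq_mul_inv, div_eq_one_iff_eq (Real.exp_pos _).ne'] at this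
  exact this

theorem toReal_weightedIntensity {A : Set X} (hA : MeasurableSet A) :
    (weightedIntensity Q A).toReal =
      ∫ μ : FiniteMeasure X, (μ A : ℝ) * Real.exp (-(μ.mass : ℝ)) ∂Q := by
  have hm : Measurable fun μ : FiniteMeasure X => (μ A : ℝ) * Real.exp (-(μ.mass : ℝ)) :=
    (measurable_finiteMeasure_apply hA).coe_nnreal_real.mul measurable_exp_neg_mass
  rw [weightedIntensity_apply Q hA, integral_eq_lintegral_of_nonneg_ae
    (Eventually.of_forall fun μ => mul_nonneg (NNReal.coe_nonneg _) (Real.exp_pos _).le)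
    hm.aestronglyMeasurable]
  congr 1
  refine lintegral_congr fun μ => ?_
  rw [ENNReal.ofReal_mul (NNReal.coe_nonneg _), ENNReal.ofReal_coe_nnreal,
    FiniteMeasure.ennreal_coeFn_eq_coeFn_toMeasure]

theorem scalingFactor_indicator (hQ : Q ≠ 0) (hinv : IsProjectivelyInvariant Q)
    (hfin : ∀ t : ℝ, 0 < t → laplaceMass Q t < ∞) {A : Set X} (hA : MeasurableSet A) (x : ℝ) :
    scalingFactor Q (A.indicator fun _ => x) (IsBddBorel.indicator_const hA x) =
      Real.exp (-((weightedIntensity Q A).toReal / (laplaceMass Q 1).toReal * x)) := by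
  rw [toReal_weightedIntensity hA, ← neg_mul, ← neg_div]
  refine eq_exp_of_map_add_of_hasDerivAt_zero
    (φ := fun x => scalingFactor Q (A.indicator fun _ => x) (IsBddBorel.indicator_const hA x))
    ?_ (fun x y => ?_) (hasDerivAt_scalingFactor_indicator hfin hA) x
  · rw [← scalingFactor_zero hQ hfin (IsBddBorel.const 0)]
    congr 1
    exact Set.indicator_zero ℝ A
  · rw [← scalingFactor_add hQ hinv hfin _ _
      ((IsBddBorel.indicator_const hA x).add (IsBddBorel.indicator_const hA y))]
    congr 1
    exact Set.indicator_add A (fun _ => x) fun _ => y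

theorem isFiniteMeasure_weightedIntensity (hfin : ∀ t : ℝ, 0 < t → laplaceMass Q t < ∞) :
    IsFiniteMeasure (weightedIntensity Q) := by
  refine ⟨?_⟩
  rw [weightedIntensity_apply Q MeasurableSet.univ]
  have h : ∀ μ : FiniteMeasure X, (μ : Measure X) Set.univ * ENNReal.ofReal (Real.exp (-μ.mass)) ≤
      ENNReal.ofReal 2 * ENNReal.ofReal (Real.exp (-(1 / 2 * (μ.mass : ℝ)))) := by
    intro μ
    rw [← FiniteMeasure.ennreal_mass, ← ENNReal.ofReal_coe_nnreal,
      ← ENNReal.ofReal_mul (NNReal.coe_nonneg _), ← ENNReal.ofReal_mul zero_le_two]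
    refine ENNReal.ofReal_le_ofReal ?_
    simpa using mul_exp_neg_le (m := (μ.mass : ℝ)) one_pos
  refine (lintegral_mono h).trans_lt ?_
  rw [lintegral_const_mul _ (measurable_exp_neg_mul_mass _).ennreal_ofReal]
  exact ENNReal.mul_lt_top ENNReal.ofReal_lt_top (hfin _ (by norm_num))

theorem ae_mass_pos (hzero : Q (massBall X 0) = 0) : ∀ᵐ μ ∂Q, 0 < μ.mass := by
  rw [ae_iff]
  convert hzero using 2
  ext μ
  simp only [massBall, Set.mem_ofPred_eq, not_lt]
  norm_cast

/-- If the integral vanished, μX would be 0 almost everywhere, although the zero measure is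
`Q`-negligible. This makes θ positive. -/
theorem weightedIntensity_univ_ne_zero (hQ : Q ≠ 0) (hzero : Q (massBall X 0) = 0) :
    weightedIntensity Q Set.univ ≠ 0 := by
  rw [weightedIntensity_apply Q MeasurableSet.univ]
  intro h
  have hm : Measurable fun μ : FiniteMeasure X =>
      (μ : Measure X) Set.univ * ENNReal.ofReal (Real.exp (-(μ.mass : ℝ))) :=
    ((Measure.measurable_coe MeasurableSet.univ).comp measurable_finiteMeasure_coe).mul
      measurable_exp_neg_mass.ennreal_ofReal
  rw [lintegral_eq_zero_iff hm] at h
  refine hQ (ae_eq_bot.1 (eventually_false_iff_eq_bot.1 ?_))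
  filter_upwards [h, ae_mass_pos hzero] with μ h1 h2
  simp only [Pi.zero_apply, mul_eq_zero, ENNReal.ofReal_eq_zero, not_le.2 (Real.exp_pos _),
    or_false, ← FiniteMeasure.ennreal_mass, ENNReal.coe_eq_zero] at h1
  exact h2.ne' h1

end ScalingFactor

/-! ## The tilted probability measure -/

section Tilted

variable {X : Type*} [MeasurableSpace X] {Q : Measure (FiniteMeasure X)}

/-- The normalization of `e^{-μX} dQ(μ)`. -/
noncomputable def tiltedLaw (Q : Measure (FiniteMeasure X)) : Measure (FiniteMeasure X) :=
  (laplaceMass Q 1)⁻¹ • Q.withDensity fun μ => ENNReal.ofReal (Real.exp (-(μ.mass : ℝ)))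

theorem isProbabilityMeasure_tiltedLaw (hQ : Q ≠ 0) (hfin : laplaceMass Q 1 < ∞) :
    IsProbabilityMeasure (tiltedLaw Q) := by
  refine ⟨?_⟩
  rw [tiltedLaw, Measure.smul_apply, withDensity_apply _ MeasurableSet.univ,
    Measure.restrict_univ, smul_eq_mul]
  convert ENNReal.inv_mul_cancel (laplaceMass_pos hQ 1).ne' hfin.ne using 2
  simp [laplaceMass]

theorem tiltedLaw_absolutelyContinuous : tiltedLaw Q ≪ Q :=
  (Measure.smul_absolutelyContinuous).trans (withDensity_absolutelyContinuous _ _)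

theorem integral_tiltedLaw (f : FiniteMeasure X → ℝ) :
    ∫ μ, f μ ∂tiltedLaw Q =
      (laplaceMass Q 1).toReal⁻¹ * ∫ μ, Real.exp (-(μ.mass : ℝ)) * f μ ∂Q := by
  have h : (Q.withDensity fun μ => ENNReal.ofReal (Real.exp (-(μ.mass : ℝ)))) =
      Q.withDensity fun μ => ((Real.exp (-(μ.mass : ℝ))).toNNReal : ℝ≥0∞) := rfl
  rw [tiltedLaw, integral_smul_measure, h,
    integral_withDensity_eq_integral_smul measurable_exp_neg_mass.real_toNNReal,
    ENNReal.toReal_inv, smul_eq_mul]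
  congr 1
  refine integral_congr_ae (Eventually.of_forall fun μ => ?_)
  simp only [NNReal.smul_def, Real.coe_toNNReal _ (Real.exp_pos _).le, smul_eq_mul]

theorem sum_apply_partition {n : ℕ} {A : Fin n → Set X} (hA : ∀ i, MeasurableSet (A i))
    (hd : Pairwise fun i j => Disjoint (A i) (A j)) (hU : ⋃ i, A i = Set.univ)
    (μ : FiniteMeasure X) : ∑ i, (μ (A i) : ℝ) = μ.mass := by
  have h : (μ.mass : ℝ≥0∞) = ∑ i, (μ (A i) : ℝ≥0∞) := by
    rw [FiniteMeasure.ennreal_mass, ← hU, measure_iUnion hd hA, tsum_fintype]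
    simp only [FiniteMeasure.ennreal_coeFn_eq_coeFn_toMeasure]
  exact_mod_cast h.symm

/-- Under the tilted law the masses of disjoint sets are independent Gamma variables. -/
theorem map_tiltedLaw_partition (hQ : Q ≠ 0) (hinv : IsProjectivelyInvariant Q)
    (hfin : ∀ t : ℝ, 0 < t → laplaceMass Q t < ∞) {n : ℕ} {A : Fin n → Set X}
    (hA : ∀ i, MeasurableSet (A i)) (hd : Pairwise fun i j => Disjoint (A i) (A j))
    (hU : ⋃ i, A i = Set.univ) :
    (tiltedLaw Q).map (fun μ i => (μ (A i) : ℝ)) =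
      Measure.pi fun i => gammaLaw (((laplaceMass Q 1)⁻¹ • weightedIntensity Q) (A i)).toReal := by
  have := isProbabilityMeasure_tiltedLaw hQ (hfin 1 one_pos)
  have hk : 0 < (laplaceMass Q 1).toReal :=
    ENNReal.toReal_pos (laplaceMass_pos hQ 1).ne' (hfin 1 one_pos).ne
  refine map_eq_pi_gammaLaw (tiltedLaw Q)
    (fun i => (((laplaceMass Q 1)⁻¹ • weightedIntensity Q) (A i)).toNNReal)
    (Y := fun μ i => μ (A i))
    (measurable_pi_lambda _ fun i => measurable_finiteMeasure_apply (hA i)) fun t => ?_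
  have ht : ∀ i, 0 < 1 + (t i : ℝ) := fun i => by positivity
  -- With this exponent the multiplier equals 1 + t_i on A_i: the 1 reproduces the tilt e^{-μX}, and
  -- t_i gives the Laplace variable.
  have hb : ∀ i, IsBddBorel ((A i).indicator fun _ => Real.log (1 + t i)) :=
    fun i => IsBddBorel.indicator_const (hA i) _
  have hs := IsBddBorel.sum Finset.univ hb
  have h1 : ∀ μ : FiniteMeasure X,
      Real.exp (-(μ.mass : ℝ)) * Real.exp (-∑ i, (t i : ℝ) * (μ (A i) : ℝ)) =
      Real.exp (-((multiply (∑ i, (A i).indicator fun _ => Real.log (1 + t i)) hs μ).mass : ℝ)) := by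
    intro μ
    rw [mass_multiply_sum_indicator hA hd hU, ← sum_apply_partition hA hd hU, ← Real.exp_add,
      ← neg_add, ← Finset.sum_add_distrib]
    congr 2
    refine Finset.sum_congr rfl fun i _ => ?_
    rw [Real.exp_log (ht i)]
    ring
  rw [integral_tiltedLaw]
  simp_rw [h1]
  rw [integral_exp_neg_mass_multiply hQ hfin, scalingFactor_sum hQ hinv hfin _ hb, mul_comm,
    mul_assoc, mul_inv_cancel₀ hk.ne', mul_one]
  refine Finset.prod_congr rfl fun i _ => ?_
  rw [scalingFactor_indicator hQ hinv hfin (hA i), Real.rpow_def_of_pos (ht i)]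
  congr 1
  change _ = _ * -(((laplaceMass Q 1)⁻¹ • weightedIntensity Q) (A i)).toReal
  rw [Measure.smul_apply, smul_eq_mul, ENNReal.toReal_mul, ENNReal.toReal_inv]
  ring

theorem measurable_normalize [Nonempty X] :
    Measurable (FiniteMeasure.normalize : FiniteMeasure X → ProbabilityMeasure X) := by
  have h : Measurable fun μ : FiniteMeasure X => (μ.normalize : Measure X) := by
    refine Measure.measurable_of_measurable_coe _ fun A hA => ?_
    -- At the zero measure `normalize` takes a fixed Dirac mass as default value, so evaluation is
    -- measurable by cases on the mass.
    have h1 : (fun μ : FiniteMeasure X => (μ.normalize : Measure X) A) = fun μ =>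
        if μ.mass = 0 then (Measure.dirac ‹Nonempty X›.some : Measure X) A
        else ((μ.mass⁻¹ * μ A : ℝ≥0) : ℝ≥0∞) := by
      funext μ
      split_ifs with h0
      · have h2 : μ.normalize = ⟨Measure.dirac ‹Nonempty X›.some,
            Measure.dirac.isProbabilityMeasure⟩ := dif_pos h0
        rw [h2]
        rfl
      · rw [← FiniteMeasure.normalize_eq_of_nonzero _ ((FiniteMeasure.mass_nonzero_iff _).1 h0),
          ProbabilityMeasure.ennreal_coeFn_eq_coeFn_toMeasure]
    rw [h1]
    exact Measurable.ite (measurable_mass (measurableSet_singleton 0)) measurable_const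
      (measurable_mass.inv.mul (measurable_finiteMeasure_apply hA)).coe_nnreal_ennreal
  exact h.subtype_mk

theorem measurable_probabilityMeasure_apply {A : Set X} (hA : MeasurableSet A) :
    Measurable fun η : ProbabilityMeasure X => η A :=
  ((Measure.measurable_coe hA).comp measurable_subtype_coe).ennreal_toNNReal

/-- The normalization of the tilted law is a Dirichlet-Ferguson measure. -/
theorem isDirichletFerguson_map_normalize [Nonempty X] (hQ : Q ≠ 0)
    (hinv : IsProjectivelyInvariant Q) (hzero : Q (massBall X 0) = 0)
    (hfin : ∀ t : ℝ, 0 < t → laplaceMass Q t < ∞) :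
    IsDirichletFerguson ((laplaceMass Q 1)⁻¹ • weightedIntensity Q)
      ((tiltedLaw Q).map FiniteMeasure.normalize) := by
  have := isProbabilityMeasure_tiltedLaw hQ (hfin 1 one_pos)
  refine ⟨Measure.isProbabilityMeasure_map measurable_normalize.aemeasurable,
    fun n A hA hd hU => ?_⟩
  have hm : Measurable fun (η : ProbabilityMeasure X) (i : Fin n) => (η (A i) : ℝ) :=
    measurable_pi_lambda _ fun i => (measurable_probabilityMeasure_apply (hA i)).coe_nnreal_real
  have hm' : Measurable fun (μ : FiniteMeasure X) (i : Fin n) => (μ (A i) : ℝ) :=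
    measurable_pi_lambda _ fun i => (measurable_finiteMeasure_apply (hA i)).coe_nnreal_real
  have hz : Measurable fun (z : Fin n → ℝ) i => z i / ∑ j, z j :=
    measurable_pi_lambda _ fun i => (measurable_pi_apply i).div
      (Finset.measurable_sum _ fun j _ => measurable_pi_apply j)
  rw [dirichletLaw, ← map_tiltedLaw_partition hQ hinv hfin hA hd hU,
    Measure.map_map hm measurable_normalize, Measure.map_map hz hm']
  refine Measure.map_congr ?_
  filter_upwards [tiltedLaw_absolutelyContinuous.ae_le (ae_mass_pos hzero)] with μ hμ
  funext i
  simp only [Function.comp_apply]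
  rw [sum_apply_partition hA hd hU,
    FiniteMeasure.normalize_eq_of_nonzero _ ((FiniteMeasure.mass_nonzero_iff _).1 hμ.ne'),
    NNReal.coe_mul, NNReal.coe_inv, div_eq_inv_mul]

end Tilted

/-! ## Uniqueness of the Dirichlet-Ferguson measure -/

section Uniqueness

variable {X : Type*} [MeasurableSpace X]

/-- Probability measures on the space of probability measures are determined by the joint laws of
finitely many evaluations. -/
theorem ext_of_map_evaluations {D D' : Measure (ProbabilityMeasure X)} [IsFiniteMeasure D]
    [IsFiniteMeasure D']
    (h : ∀ J : Finset {A : Set X // MeasurableSet A},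
      D.map (fun η (A : J) => (η (A : Set X) : ℝ)) =
        D'.map fun η (A : J) => (η (A : Set X) : ℝ)) : D = D' := by
  let Ψ : ProbabilityMeasure X → {A : Set X // MeasurableSet A} → ℝ := fun η A => η A
  have hΨ : Measurable Ψ :=
    measurable_pi_lambda _ fun A => (measurable_probabilityMeasure_apply A.2).coe_nnreal_real
  have hlim : ∀ E : Measure (ProbabilityMeasure X), IsProjectiveLimit (E.map Ψ)
      fun J : Finset {A : Set X // MeasurableSet A} =>
        E.map fun η (A : J) => (η (A : Set X) : ℝ) := by
    intro E J
    rw [Measure.map_map (Finset.measurable_restrict J) hΨ]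
    rfl
  have hD' := hlim D'
  simp_rw [← h] at hD'
  have hmap : D.map Ψ = D'.map Ψ := by
    have : ∀ J : Finset {A : Set X // MeasurableSet A},
        IsFiniteMeasure (D.map fun η (A : J) => (η (A : Set X) : ℝ)) :=
      fun J => Measure.isFiniteMeasure_map D _
    exact (hlim D).unique hD'
  -- The σ-algebra on probability measures is generated by evaluations, hence pulled back along Ψ.
  -- Equality of the two laws of Ψ is therefore enough.
  have hcomap : @Measurable (ProbabilityMeasure X) (Measure X)
      (MeasurableSpace.comap Ψ inferInstance) _ (fun η => (η : Measure X)) := by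
    refine @Measure.measurable_of_measurable_coe _ _ _ (MeasurableSpace.comap Ψ inferInstance) _
      fun A hA => ?_
    have h1 : (fun η : ProbabilityMeasure X => (η : Measure X) A) =
        (fun y : {A : Set X // MeasurableSet A} → ℝ => ENNReal.ofReal (y ⟨A, hA⟩)) ∘ Ψ := by
      funext η
      simp [Ψ]
    rw [h1]
    exact (measurable_pi_apply _).ennreal_ofReal.comp (comap_measurable Ψ)
  refine Measure.ext fun S hS => ?_
  obtain ⟨T, hT, rfl⟩ := hS
  obtain ⟨U, hU, hUT⟩ := hcomap hT
  change D ((fun η : ProbabilityMeasure X => (η : Measure X)) ⁻¹' T) =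
    D' ((fun η : ProbabilityMeasure X => (η : Measure X)) ⁻¹' T)
  rw [← hUT, ← Measure.map_apply hΨ hU, ← Measure.map_apply hΨ hU, hmap]

/-- Finitely many measurable sets generate a finite partition into atoms, and the mass of each set
is the sum of the masses of its atoms. The prescribed partition laws thus fix every joint law of
evaluations. -/
theorem IsDirichletFerguson.unique {α : Measure X} {D D' : Measure (ProbabilityMeasure X)}
    (hD : IsDirichletFerguson α D) (hD' : IsDirichletFerguson α D') : D = D' := by
  classical
  have := hD.isProbabilityMeasure
  have := hD'.isProbabilityMeasure
  refine ext_of_map_evaluations fun J => ?_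
  -- The atoms are the fibres of the map sending a point to its membership pattern. Some may be
  -- empty, which the partition condition permits.
  let f : X → (J → Prop) := fun x A => x ∈ (A : Set X)
  have hf : Measurable f := measurable_pi_lambda _ fun A => measurable_mem.2 A.1.2
  let e := (Fintype.equivFin (J → Prop)).symm
  let B : Fin (Fintype.card (J → Prop)) → Set X := fun i => f ⁻¹' {e i}
  have hB : ∀ i, MeasurableSet (B i) := fun i => hf (measurableSet_singleton _)
  have hd : Pairwise fun i j => Disjoint (B i) (B j) := by
    intro i j hij
    refine Disjoint.preimage f (Set.disjoint_singleton.2 fun h => hij (e.injective h))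
  have hU : ⋃ i, B i = Set.univ := by
    refine Set.eq_univ_of_forall fun x => Set.mem_iUnion.2 ⟨e.symm (f x), ?_⟩
    simp [B]
  let L : (Fin (Fintype.card (J → Prop)) → ℝ) → J → ℝ :=
    fun z A => ∑ i with e i A, z i
  have hL : Measurable L := measurable_pi_lambda _ fun A =>
    Finset.measurable_sum _ fun i _ => measurable_pi_apply i
  have hm : Measurable fun (η : ProbabilityMeasure X) i => (η (B i) : ℝ) :=
    measurable_pi_lambda _ fun i => (measurable_probabilityMeasure_apply (hB i)).coe_nnreal_real
  have hsplit : (fun (η : ProbabilityMeasure X) (A : J) => (η (A : Set X) : ℝ)) =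
      L ∘ fun η i => (η (B i) : ℝ) := by
    funext η A
    have hA : (A : Set X) = ⋃ i ∈ Finset.univ.filter fun i => e i A, B i := by
      ext x
      simp only [Finset.mem_filter, Finset.mem_univ, true_and, Set.mem_iUnion, exists_prop, B,
        Set.mem_preimage, Set.mem_singleton_iff]
      constructor
      · exact fun hx => ⟨e.symm (f x), by simpa [f] using hx, by simp⟩
      · rintro ⟨i, hi, hx⟩
        rw [← hx] at hi
        exact hi
    have h1 : (η (A : Set X) : ℝ≥0∞) = ∑ i with e i A, (η (B i) : ℝ≥0∞) := by
      simp only [ProbabilityMeasure.ennreal_coeFn_eq_coeFn_toMeasure]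
      conv_lhs => rw [hA]
      exact measure_biUnion_finset (fun i _ j _ hij => hd hij) fun i _ => hB i
    simp only [Function.comp_apply, L]
    exact_mod_cast h1
  rw [hsplit, ← Measure.map_map hL hm, ← Measure.map_map hL hm, hD.map_partition _ B hB hd hU,
    hD'.map_partition _ B hB hd hU]

theorem IsDirichletFerguson.dirichletFerguson_eq {α : Measure X}
    {D : Measure (ProbabilityMeasure X)} (hD : IsDirichletFerguson α D) :
    dirichletFerguson α = D := by
  have h : ∃ D, IsDirichletFerguson α D := ⟨D, hD⟩
  rw [dirichletFerguson, dif_pos h]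
  exact h.choose_spec.unique hD

end Uniqueness

/-! ## Polar decomposition -/

section Lambda

theorem lambdaMeasure_Iic {θ : ℝ} (hθ : 0 < θ) {r : ℝ} (hr : 0 ≤ r) :
    lambdaMeasure θ (Set.Iic r) = ENNReal.ofReal (r ^ θ / (θ * Real.Gamma θ)) := by
  have hG := Real.Gamma_pos_of_pos hθ
  have hint : IntegrableOn (fun t : ℝ => t ^ (θ - 1) / Real.Gamma θ) (Set.Ioc 0 r) :=
    ((intervalIntegrable_iff_integrableOn_Ioc_of_le hr).1
      (intervalIntegral.intervalIntegrable_rpow' (by linarith))).div_const _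
  rw [lambdaMeasure, withDensity_apply _ measurableSet_Iic, Measure.restrict_restrict
    measurableSet_Iic, Set.inter_comm, Set.Ioi_inter_Iic,
    ← ofReal_integral_eq_lintegral_ofReal hint ?_, ← intervalIntegral.integral_of_le hr,
    intervalIntegral.integral_div, integral_rpow (Or.inl (by linarith)), sub_add_cancel,
    Real.zero_rpow hθ.ne', sub_zero, div_div]
  filter_upwards [ae_restrict_mem measurableSet_Ioc] with t ht
  exact div_nonneg (Real.rpow_nonneg ht.1.le _) hG.le

theorem lambdaMeasure_Iic_of_nonpos (θ : ℝ) {r : ℝ} (hr : r ≤ 0) :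
    lambdaMeasure θ (Set.Iic r) = 0 := by
  rw [lambdaMeasure, withDensity_apply _ measurableSet_Iic, Measure.restrict_restrict
    measurableSet_Iic, Set.inter_comm, Set.Ioi_inter_Iic, Set.Ioc_eq_empty (not_lt.2 hr)]
  simp

/-- This normalization is what makes k_1 the exact constant in front of the multiplicative Lebesgue
measure. -/
theorem lintegral_exp_neg_lambdaMeasure {θ : ℝ} (hθ : 0 < θ) :
    ∫⁻ t, ENNReal.ofReal (Real.exp (-t)) ∂lambdaMeasure θ = 1 := by
  have hG := Real.Gamma_pos_of_pos hθ
  rw [lambdaMeasure, lintegral_withDensity_eq_lintegral_mul _ (by fun_prop) (by fun_prop)]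
  have h : ∀ t ∈ Set.Ioi (0 : ℝ), ((fun t : ℝ => ENNReal.ofReal (t ^ (θ - 1) / Real.Gamma θ)) *
      fun t => ENNReal.ofReal (Real.exp (-t))) t =
      ENNReal.ofReal (Real.exp (-t) * t ^ (θ - 1) / Real.Gamma θ) := by
    intro t ht
    rw [Pi.mul_apply, ← ENNReal.ofReal_mul (div_nonneg (Real.rpow_nonneg (le_of_lt ht) _) hG.le)]
    congr 1
    ring
  rw [setLIntegral_congr_fun measurableSet_Ioi h, ← ofReal_integral_eq_lintegral_ofReal
    ((Real.GammaIntegral_convergent hθ).div_const _) ?_, integral_div, ← Real.Gamma_eq_integral hθ,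
    div_self hG.ne', ENNReal.ofReal_one]
  filter_upwards [ae_restrict_mem measurableSet_Ioi] with t ht
  exact div_nonneg (mul_nonneg (Real.exp_pos _).le (Real.rpow_nonneg (le_of_lt ht) _)) hG.le

instance sigmaFinite_lambdaMeasure (θ : ℝ) : SigmaFinite (lambdaMeasure θ) := by
  unfold lambdaMeasure
  infer_instance

/-- A homogeneous measure on the half-line is a multiple of `lambdaMeasure`. -/
theorem eq_smul_lambdaMeasure {θ : ℝ} (hθ : 0 < θ) {m : Measure ℝ} (h0 : m (Set.Iic 0) = 0)
    (h1 : m (Set.Iic 1) ≠ ∞)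
    (hr : ∀ r : ℝ, 0 < r → m (Set.Iic r) = ENNReal.ofReal (r ^ θ) * m (Set.Iic 1)) :
    ∃ c : ℝ≥0∞, m = c • lambdaMeasure θ := by
  have hG : 0 < θ * Real.Gamma θ := mul_pos hθ (Real.Gamma_pos_of_pos hθ)
  -- The reference measure gives (-∞, 1] mass 1/(θ Γ(θ)), which forces this constant.
  refine ⟨m (Set.Iic 1) * ENNReal.ofReal (θ * Real.Gamma θ), ?_⟩
  have hfin : ∀ r, m (Set.Iic r) ≠ ∞ := by
    intro r
    rcases le_or_gt r 0 with h | h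
    · exact ((measure_mono (Set.Iic_subset_Iic.2 h)).trans_lt (h0 ▸ ENNReal.zero_lt_top)).ne
    · rw [hr r h]
      exact ENNReal.mul_ne_top ENNReal.ofReal_ne_top h1
  have heq : ∀ r, m (Set.Iic r) =
      ((m (Set.Iic 1) * ENNReal.ofReal (θ * Real.Gamma θ)) • lambdaMeasure θ) (Set.Iic r) := by
    intro r
    rw [Measure.smul_apply, smul_eq_mul]
    rcases le_or_gt r 0 with h | h
    · rw [lambdaMeasure_Iic_of_nonpos θ h, mul_zero]
      exact measure_mono_null (Set.Iic_subset_Iic.2 h) h0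
    · rw [lambdaMeasure_Iic hθ h.le, hr r h, mul_assoc, ← ENNReal.ofReal_mul hG.le,
        mul_div_cancel₀ _ hG.ne', mul_comm]
  refine Measure.ext_of_Ioc' _ _ (fun a b _ => ?_) fun a b hab => ?_
  · exact ((measure_mono Set.Ioc_subset_Iic_self).trans_lt (hfin b).lt_top).ne
  · rw [← Set.Iic_sdiff_Iic, measure_sdiff (Set.Iic_subset_Iic.2 hab.le)
      measurableSet_Iic.nullMeasurableSet (hfin a), measure_sdiff (Set.Iic_subset_Iic.2 hab.le)
      measurableSet_Iic.nullMeasurableSet ((heq a) ▸ hfin a), heq a, heq b]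

end Lambda

section Polar

variable {X : Type*} [MeasurableSpace X] {Q : Measure (FiniteMeasure X)}

theorem normalize_multiply_const [Nonempty X] (x : ℝ) (μ : FiniteMeasure X) :
    (multiply (fun _ => x) (IsBddBorel.const x) μ).normalize = μ.normalize := by
  by_cases hμ : μ = 0
  · rw [multiply_const, hμ, smul_zero]
  have hc : (Real.exp x).toNNReal ≠ 0 := (Real.toNNReal_pos.2 (Real.exp_pos x)).ne'
  rw [multiply_const]
  refine ProbabilityMeasure.eq_of_forall_apply_eq _ _ fun A _ => ?_
  rw [FiniteMeasure.normalize_eq_of_nonzero _ hμ,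
    FiniteMeasure.normalize_eq_of_nonzero _ (smul_ne_zero hc hμ), FiniteMeasure.mass,
    FiniteMeasure.smul_apply, FiniteMeasure.smul_apply, smul_eq_mul, smul_eq_mul,
    FiniteMeasure.mass, mul_inv, mul_mul_mul_comm, inv_mul_cancel₀ hc, one_mul]

/-- Markov's inequality for e^{-μX}, which is at least e^{-r} on the ball. -/
theorem measure_massBall_lt_top (hfin : laplaceMass Q 1 < ∞) (r : ℝ) :
    Q (massBall X r) < ∞ := by
  have h := mul_meas_ge_le_lintegral (μ := Q)
    (measurable_exp_neg_mul_mass (X := X) 1).ennreal_ofReal (ENNReal.ofReal (Real.exp (-r)))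
  have hpos : 0 < ENNReal.ofReal (Real.exp (-r)) := ENNReal.ofReal_pos.2 (Real.exp_pos _)
  refine (measure_mono fun μ hμ => ?_).trans_lt
    (ENNReal.lt_top_of_mul_ne_top_right (h.trans_lt hfin).ne hpos.ne')
  rw [Set.mem_ofPred_eq, one_mul]
  exact ENNReal.ofReal_le_ofReal (Real.exp_le_exp.2 (neg_le_neg hμ))

/-- Constant multipliers are the case A = X of the exponential formula. With x = log r the factor is
r^{-θ}, which is homogeneity of degree θ along rays. -/
theorem map_multiply_const (hQ : Q ≠ 0) (hinv : IsProjectivelyInvariant Q)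
    (hfin : ∀ t : ℝ, 0 < t → laplaceMass Q t < ∞) (x : ℝ) :
    Q.map (multiply (fun _ => x) (IsBddBorel.const x)) =
      ENNReal.ofReal (Real.exp (-((weightedIntensity Q Set.univ).toReal /
        (laplaceMass Q 1).toReal * x))) • Q := by
  rw [map_multiply_eq hQ hinv hfin, ← scalingFactor_indicator hQ hinv hfin MeasurableSet.univ]
  simp only [Set.indicator_univ]

/-- In polar coordinates, `Q` is the product of the Dirichlet-Ferguson measure and of
`lambdaMeasure`. -/
theorem map_polar_eq [Nonempty X] (hQ : Q ≠ 0) (hinv : IsProjectivelyInvariant Q)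
    (hzero : Q (massBall X 0) = 0) (hfin : ∀ t : ℝ, 0 < t → laplaceMass Q t < ∞) {θ : ℝ}
    (hθ : θ = (weightedIntensity Q Set.univ).toReal / (laplaceMass Q 1).toReal) (hθ0 : 0 < θ) :
    Q.map (fun μ => (μ.normalize, (μ.mass : ℝ))) =
      laplaceMass Q 1 • ((tiltedLaw Q).map FiniteMeasure.normalize).prod (lambdaMeasure θ) := by
  have hk0 := laplaceMass_pos hQ 1
  have hkT := hfin 1 one_pos
  have hprob := isProbabilityMeasure_tiltedLaw hQ hkT
  have hN := measurable_normalize (X := X)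
  have hm := (measurable_mass (X := X)).coe_nnreal_real
  have hDfin := Measure.isFiniteMeasure_map (tiltedLaw Q) (FiniteMeasure.normalize (Ω := X))
  -- Fix a set of directions: the cone over it is invariant under dilations, so the radial law on it
  -- is homogeneous and only its total weight depends on `E`.
  have key : ∀ E : Set (ProbabilityMeasure X), MeasurableSet E →
      (Q.restrict (FiniteMeasure.normalize ⁻¹' E)).map (fun μ => (μ.mass : ℝ)) =
        (laplaceMass Q 1 * (tiltedLaw Q).map FiniteMeasure.normalize E) • lambdaMeasure θ := by
    intro E hE
    have hIic : ∀ r : ℝ, (Q.restrict (FiniteMeasure.normalize ⁻¹' E)).map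
        (fun μ => (μ.mass : ℝ)) (Set.Iic r) =
        Q (massBall X r ∩ FiniteMeasure.normalize ⁻¹' E) := by
      intro r
      rw [Measure.map_apply hm measurableSet_Iic, Measure.restrict_apply (hm measurableSet_Iic)]
      rfl
    obtain ⟨c, hc⟩ := eq_smul_lambdaMeasure hθ0
      (m := (Q.restrict (FiniteMeasure.normalize ⁻¹' E)).map fun μ => (μ.mass : ℝ))
      (by rw [hIic]; exact measure_mono_null Set.inter_subset_left hzero)
      (by rw [hIic]
          exact ((measure_mono Set.inter_subset_left).trans_lt (measure_massBall_lt_top hkT 1)).ne)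
      (fun r hr => by
        have h := congrArg (fun m : Measure (FiniteMeasure X) =>
          m (massBall X r ∩ FiniteMeasure.normalize ⁻¹' E))
          (map_multiply_const hQ hinv hfin (Real.log r))
        simp only [Measure.smul_apply, smul_eq_mul] at h
        rw [Measure.map_apply (measurable_multiply _ _)
          ((measurableSet_massBall r).inter (hN hE)), ← hθ] at h
        have hpre : multiply (fun _ : X => Real.log r) (IsBddBorel.const _) ⁻¹'
            (massBall X r ∩ FiniteMeasure.normalize ⁻¹' E) =
            massBall X 1 ∩ FiniteMeasure.normalize ⁻¹' E := by
          ext μ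
          simp only [massBall, Set.mem_preimage, Set.mem_inter_iff, Set.mem_ofPred_eq,
            mass_multiply_const, normalize_multiply_const, Real.exp_log hr]
          rw [mul_le_iff_le_one_right hr]
        rw [hIic, hIic, ← hpre, h, ← mul_assoc, ← ENNReal.ofReal_mul (Real.rpow_nonneg hr.le _),
          Real.rpow_def_of_pos hr, ← Real.exp_add, mul_comm θ, add_neg_cancel, Real.exp_zero,
          ENNReal.ofReal_one, one_mul])
    -- Integrating e^{-t} isolates the constant: on the other side it yields the mass that e^{-μX}
    -- dQ gives to the cone, which is k_1 times its tilted probability.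
    have hcE : laplaceMass Q 1 * (tiltedLaw Q).map FiniteMeasure.normalize E = c := by
      have h1 := congrArg (fun m : Measure ℝ => ∫⁻ t, ENNReal.ofReal (Real.exp (-t)) ∂m) hc
      simp only [lintegral_smul_measure, lintegral_exp_neg_lambdaMeasure hθ0, smul_eq_mul,
        mul_one] at h1
      rw [lintegral_map (by fun_prop) hm] at h1
      rw [← h1, Measure.map_apply hN hE, tiltedLaw, Measure.smul_apply, smul_eq_mul,
        withDensity_apply _ (hN hE), ← mul_assoc, ENNReal.mul_inv_cancel hk0.ne' hkT.ne, one_mul]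
    rw [hcE, hc]
  have hfinite : IsFiniteMeasure (laplaceMass Q 1 • (tiltedLaw Q).map FiniteMeasure.normalize) :=
    Measure.smul_finite _ hkT.ne
  rw [← Measure.prod_smul_left]
  refine (Measure.prod_eq fun E B hE hB => ?_).symm
  rw [Measure.map_apply (hN.prodMk hm) (hE.prod hB), Measure.smul_apply, smul_eq_mul]
  have h := congrArg (fun m : Measure ℝ => m B) (key E hE)
  simp only [Measure.smul_apply, smul_eq_mul] at h
  rw [← h, Measure.map_apply hm hB, Measure.restrict_apply (hm hB), Set.inter_comm]
  rfl

/-- This holds at the zero measure too, whatever default direction `normalize` picks, so polar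
coordinates are inverted everywhere and not merely almost everywhere. -/
theorem scale_normalize_mass [Nonempty X] (μ : FiniteMeasure X) :
    scale (μ.normalize, (μ.mass : ℝ)) = μ := by
  rw [scale, Real.toNNReal_coe]
  exact μ.self_eq_mass_smul_normalize.symm

end Polar

/-! ### Proof of the proposition -/

theorem propositionp {X : Type*} [TopologicalSpace X] [PolishSpace X]
    [MeasurableSpace X] [BorelSpace X]
    (Q : Measure (FiniteMeasure X)) (hQ : Q ≠ 0) (hinv : IsProjectivelyInvariant Q)
    (hzero : Q (massBall X 0) = 0)
    (hball : ∃ r : ℝ, 0 < r ∧ 0 < Q (massBall X r) ∧ Q (massBall X r) < ∞) :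
    (∀ t : ℝ, 0 < t → 0 < laplaceMass Q t ∧ laplaceMass Q t < ∞) ∧
    (IsFiniteMeasure (weightedIntensity Q) ∧ weightedIntensity Q ≠ 0) ∧
    ∀ (θ : ℝ) (ν : Measure X),
      θ = (weightedIntensity Q Set.univ).toReal / (laplaceMass Q 1).toReal →
      ν = normalization (weightedIntensity Q) →
      (∃! D : Measure (ProbabilityMeasure X), IsDirichletFerguson (ENNReal.ofReal θ • ν) D) ∧
      Q = laplaceMass Q 1 • multiplicativeLebesgue θ ν := by
  obtain ⟨r, hr, h0, h1⟩ := hball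
  have hfin : ∀ t : ℝ, 0 < t → laplaceMass Q t < ∞ :=
    fun t ht => laplaceMass_lt_top hQ hinv hr h0 h1 ht
  have hαfin := isFiniteMeasure_weightedIntensity hfin
  have hα0 := weightedIntensity_univ_ne_zero hQ hzero
  have hαT : weightedIntensity Q Set.univ ≠ ∞ := measure_ne_top _ _
  have hk0 := laplaceMass_pos hQ 1
  have hkT := hfin 1 one_pos
  have hk : 0 < (laplaceMass Q 1).toReal := ENNReal.toReal_pos hk0.ne' hkT.ne
  refine ⟨fun t ht => ⟨laplaceMass_pos hQ t, hfin t ht⟩,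
    ⟨hαfin, fun h => hα0 (Measure.measure_univ_eq_zero.2 h)⟩, ?_⟩
  rintro θ ν hθ rfl
  -- Normalization of finite measures requires a point; an empty space would give α zero mass.
  have hX : Nonempty X := by
    by_contra hX
    rw [not_nonempty_iff] at hX
    exact hα0 (by rw [Set.univ_eq_empty_iff.2 hX, measure_empty])
  have hθ0 : 0 < θ := hθ ▸ div_pos (ENNReal.toReal_pos hα0 hαT) hk
  -- The total mass of α cancels, so θν is exactly the intensity α/k_1 found for the normalized
  -- tilted law.
  have hβ : ENNReal.ofReal θ • normalization (weightedIntensity Q) =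
      (laplaceMass Q 1)⁻¹ • weightedIntensity Q := by
    rw [normalization, smul_smul, hθ, ENNReal.ofReal_div_of_pos hk, ENNReal.ofReal_toReal hαT,
      ENNReal.ofReal_toReal hkT.ne, div_eq_mul_inv, mul_right_comm,
      ENNReal.mul_inv_cancel hα0 hαT, one_mul]
  have hD := isDirichletFerguson_map_normalize hQ hinv hzero hfin
  rw [multiplicativeLebesgue, hβ, hD.dirichletFerguson_eq, ← Measure.map_smul,
    ← map_polar_eq hQ hinv hzero hfin hθ hθ0, Measure.map_map measurable_scale
      (measurable_normalize.prodMk measurable_mass.coe_nnreal_real)]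
  refine ⟨⟨_, hD, fun D' hD' => hD'.unique hD⟩, ?_⟩
  have hid : scale ∘ (fun μ : FiniteMeasure X => (μ.normalize, (μ.mass : ℝ))) = id :=
    funext scale_normalize_mass
  rw [hid, Measure.map_id]
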